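/- Languages are subsets of $\Sigma^*$ with $\Sigma=\{0,1\}$, and a complexity class is a set of languages. Machines are oracle Turing machines with a polynomial clock that is independent of the oracles. Put $\Sigma_0^p=\Pi_0^p=\Delta_0^p=\mathrm{P}$ and, for $i>0$, $\Sigma_i^p=\mathrm{NP}^{\Sigma_{i-1}^p}$, $\Pi_i^p=\mathrm{co}\Sigma_i^p$, $\Delta_i^p=\mathrm{P}^{\Sigma_{i-1}^p}$ (so $\Delta_1^p=\mathrm{P}$). For complexity classes $\mathcal C,\mathcal D$, the following classes consist of the languages accepted, for some $C\in\mathcal C$ and $D\in\mathcal D$, by a deterministic polynomial-time oracle machine that is restricted to making: - $\mathrm{P}^{\mathcal C:\mathcal D}$: at most one query to $C$ followed by at most one query to $D$; - $\mathrm{P}_{1,1\text{-tt}}^{(\mathcal C,\mathcal D)}$: simultaneously at most one query to $C$ and at most one query to $D$; - $\mathrm{P}^{\mathcal C,\mathcal D}$: at most one query to $C$ and at most one query to $D$, in arbitrary order; - $\mathrm{P}^{\mathcal C[1],\mathcal D[poly]}$: at most one query to $C$ and polynomially many queries to $D$, in arbitrary order (the query to $C$ may come between queries to $D$). Corollary.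 1. For all $k\ge 0$ and $j>0$, $$\mathrm{P}_{1,1\text{-tt}}^{(\Delta_j^p,\Sigma_k^p)}=\mathrm{P}^{\Delta_j^p:\Sigma_k^p}=\mathrm{P}^{\Sigma_k^p:\Delta_j^p}=\mathrm{P}^{\Sigma_k^p,\Delta_j^p}=\begin{cases}\Delta_j^p&\text{if } j>k,\\ \mathrm{P}^{\Sigma_k^p[1],\Sigma_{j-1}^p[poly]}&\text{if } j\le k.\end{cases}$$ 2. For all $j,k\ge 0$, $$\mathrm{P}_{1,1\text{-tt}}^{(\Delta_j^p,\Sigma_k^p\cap\Pi_k^p)}=\mathrm{P}^{\Delta_j^p:\Sigma_k^p\cap\Pi_k^p}=\mathrm{P}^{\Sigma_k^p\cap\Pi_k^p:\Delta_j^p}=\mathrm{P}^{\Sigma_k^p\cap\Pi_k^p,\Delta_j^p}=\begin{cases}\Delta_j^p&\text{if } j>k,\\ \Sigma_k^p\cap\Pi_k^p&\text{if } j\le k.\end{cases}$$ 3. For all $j,k\ge 0$, $$\mathrm{P}_{1,1\text{-tt}}^{(\Sigma_j^p\cap\Pi_j^p,\Sigma_k^p\cap\Pi_k^p)}=\mathrm{P}^{\Sigma_j^p\cap\Pi_j^p:\Sigma_k^p\cap\Pi_k^p}=\mathrm{P}^{\Sigma_k^p\cap\Pi_k^p:\Sigma_j^p\cap\Pi_j^p}=\mathrm{P}^{\Sigma_k^p\cap\Pi_k^p,\Sigma_j^p\cap\Pi_j^p}=\Sigma_{\max(j,k)}^p\cap\Pi_{\max(j,k)}^p.$$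 -/

import Mathlib

namespace QueryOrder

/-- Subsets of `Σ*`, where `Σ = {0, 1}`. -/
abbrev Lang := Set (List Bool)

/-- A complexity class is any collection of subsets of `Σ*`. -/
abbrev CClass := Set Lang

/-- The class `co C` of complements of members of `C`. -/
def co (C : CClass) : CClass := {L | Lᶜ ∈ C}

/-! ### Oracle Turing machines

As in Mathlib's `Turing.TM2`, the storage of a machine consists of finitely many stacks (a tape with
a two-way head is a pair of stacks: the part to the left of the head and the part from the head on).
One instruction is executed per time step.  `ι` is the set of oracles, and `κ` is the set of
alternatives of a branching step: `Unit` for deterministic machines, `Bool` for nondeterministic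
ones. -/

/-- The instruction attached to a control state; `K` is the set of stacks, `Q` that of states. -/
inductive Instr (ι κ K Q : Type) where
  /-- write a symbol on top of a stack -/
  | push (k : K) (b : Bool) (next : Q)
  /-- remove and read the top symbol of a stack (`none` if the stack is empty) -/
  | pop (k : K) (next : Option Bool → Q)
  /-- go to one of the states `next c` -/
  | branch (next : κ → Q)
  /-- query, simultaneously, every oracle `i ∈ S` about the word on its query stack -/
  | query (S : Finset ι) (next : (ι → Bool) → Q)
  /-- stop, and accept or reject -/
  | halt (accept : Bool)

/-- An oracle Turing machine with oracles indexed by `ι` and branching alternatives `κ`. -/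
structure OTM (ι κ : Type) where
  /-- control states -/
  Q : Type
  /-- stacks -/
  K : Type
  [finQ : Finite Q]
  [finK : Finite K]
  [decK : DecidableEq K]
  /-- initial state -/
  start : Q
  /-- the stack that holds the input -/
  inp : K
  /-- the stack that holds the queries to each oracle -/
  qry : ι → K
  /-- the program -/
  instr : Q → Instr ι κ K Q

attribute [instance] OTM.decK OTM.finQ OTM.finK

namespace OTM

variable {ι κ : Type}

/-- Configurations.  The words on the stacks are read from the top.  The component `log` is not
accessible to the machine: it lists, in chronological order, the query steps made so far, each
represented by the set of oracles that it queries. -/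
structure Cfg (M : OTM ι κ) where
  state : M.Q
  stk : M.K → List Bool
  log : List (Finset ι)

variable (M : OTM ι κ)

/-- The initial configuration on input `x`. -/
def initCfg (x : List Bool) : M.Cfg where
  state := M.start
  stk := Function.update (fun _ => []) M.inp x
  log := []

open Classical in
/-- One step with oracles `A`, where `c` is the alternative taken if the step is a branching step.
A query step answers the queries and empties the query stacks that were used; a halted machine does
not move. -/
noncomputable def step (A : ι → Lang) (c : κ) (s : M.Cfg) : M.Cfg :=
  match M.instr s.state with
  | .push k b q => { s with state := q, stk := Function.update s.stk k (b :: s.stk k) }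
  | .pop k next =>
      { s with state := next (s.stk k).head?, stk := Function.update s.stk k (s.stk k).tail }
  | .branch next => { s with state := next c }
  | .query S next =>
      { state := next (fun i => decide (i ∈ S ∧ s.stk (M.qry i) ∈ A i))
        stk := fun k => if ∃ i ∈ S, M.qry i = k then [] else s.stk k
        log := s.log ++ [S] }
  | .halt _ => s

/-- The configuration reached after `t` steps on input `x` along the branch `c`. -/
noncomputable def run (A : ι → Lang) (c : ℕ → κ) (x : List Bool) : ℕ → M.Cfg
  | 0 => M.initCfg x
  | t + 1 => M.step A (c t) (run A c x t)

/-- The machine has a polynomial clock, independent of the oracles (and valid on all branches). -/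
def PolyTime : Prop :=
  ∃ p : Polynomial ℕ, ∀ (A : ι → Lang) (c : ℕ → κ) (x : List Bool),
    ∃ b, M.instr (M.run A c x (p.eval x.length)).state = .halt b

/-- The machine is restricted to computations whose sequence of query steps satisfies `R`. -/
def Restricted (R : List (Finset ι) → Prop) : Prop :=
  ∀ (A : ι → Lang) (c : ℕ → κ) (x : List Bool) (t : ℕ), R (M.run A c x t).log

/-- The language accepted with oracles `A`: the inputs with an accepting computation. -/
def language (A : ι → Lang) : Lang :=
  {x | ∃ (c : ℕ → κ) (t : ℕ), M.instr (M.run A c x t).state = .halt true}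

end OTM

/-- Deterministic oracle machines with oracles `ι`. -/
abbrev DTM (ι : Type) := OTM ι Unit

/-- Nondeterministic oracle machines with oracles `ι`. -/
abbrev NTM (ι : Type) := OTM ι Bool

/-! ### The polynomial hierarchy -/

/-- The class `P`. -/
def P : CClass := {L | ∃ M : DTM Empty, M.PolyTime ∧ L = M.language Empty.elim}

/-- The class `P^C`. -/
def PRel (C : CClass) : CClass :=
  {L | ∃ A ∈ C, ∃ M : DTM Unit, M.PolyTime ∧ L = M.language (fun _ => A)}

/-- The class `NP^C`. -/
def NPRel (C : CClass) : CClass :=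
  {L | ∃ A ∈ C, ∃ M : NTM Unit, M.PolyTime ∧ L = M.language (fun _ => A)}

/-- `Σ_i^p`. -/
def SigmaP : ℕ → CClass
  | 0 => P
  | i + 1 => NPRel (SigmaP i)

/-- `Π_i^p`. -/
def PiP : ℕ → CClass
  | 0 => P
  | i + 1 => co (SigmaP (i + 1))

/-- `Δ_i^p`. -/
def DeltaP : ℕ → CClass
  | 0 => P
  | i + 1 => PRel (SigmaP i)

/-! ### Classes given by restricted access to two oracles

Oracle `0` is taken from `C` and oracle `1` from `D`. -/

/-- The languages `L(M^{A, B})` with `A ∈ C`, `B ∈ D` and `M` a deterministic polynomial-time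
machine whose query steps are restricted by `R`. -/
def PTwo (R : List (Finset (Fin 2)) → Prop) (C D : CClass) : CClass :=
  {L | ∃ A ∈ C, ∃ B ∈ D, ∃ M : DTM (Fin 2), M.PolyTime ∧ M.Restricted R ∧ L = M.language ![A, B]}

/-- `P^{C:D}`: at most one query to `C` followed by at most one query to `D`. -/
def POrdered (C D : CClass) : CClass :=
  PTwo (fun l => l.Sublist [{0}, {1}]) C D

/-- `P_{1,1-tt}^{(C,D)}`: simultaneously at most one query to `C` and at most one query to `D`. -/
def PParallel (C D : CClass) : CClass :=
  PTwo (fun l => l.length ≤ 1) C D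

/-- `P^{C,D}`: at most one query to `C` and at most one query to `D`, in arbitrary order. -/
def PAnyOrder (C D : CClass) : CClass :=
  PTwo (fun l => l.Sublist [{0}, {1}] ∨ l.Sublist [{1}, {0}]) C D

/-- `P^{C[1],D[poly]}`: at most one query to `C` and any number of queries to `D` (polynomially
many, by the clock), in arbitrary order. -/
def POnePoly (C D : CClass) : CClass :=
  PTwo (fun l => (∀ S ∈ l, S = {0} ∨ S = {1}) ∧ l.count {0} ≤ 1) C D

end QueryOrder

/-! A machine whose queries are answered by running other machines is again a machine. Hence `P^C`
is closed under polynomial-time Turing reductions, and `NP^C` contains every language of the form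
"some computation accepts, and its answers can be verified", as long as the verification of each
answer is an `NP^C` computation.

Let `M` be deterministic and query `A ∈ NP^D` at most once. Compare the computations of `M` in which
this query is always answered `no` and always answered `yes`. If the `yes` computation queries a
word of `A`, then it is the actual one; otherwise the `no` computation is, because the two agree up
to the query. So the language of `M` is the symmetric difference of the language of the `no`
computation and of an `NP^D` set, namely of the inputs on which the two outcomes differ and the
answer `yes` is correct. Conversely, a symmetric difference of a language in `C` and a language in
`D` can be computed by querying `C` and `D` once each, in any order or simultaneously. Thus all
query orders define the same class. It is `Δ_j` if the `Σ_k` query can be absorbed.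

If both oracles are in `Σ_k ∩ Π_k` and are queried at most once, then the answers can be guessed in
advance, and each guess can be verified in `Σ_k`. -/

namespace QueryOrder

namespace OTM

variable {ι κ : Type} (M : OTM ι κ)

/-- The configuration reached from `s` after `t` steps along the branch `c`. -/
noncomputable def runFrom (A : ι → Lang) (c : ℕ → κ) (s : M.Cfg) : ℕ → M.Cfg
  | 0 => s
  | t + 1 => M.step A (c t) (runFrom A c s t)

theorem run_eq_runFrom (A : ι → Lang) (c : ℕ → κ) (x : List Bool) (t : ℕ) :
    M.run A c x t = M.runFrom A c (M.initCfg x) t := by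
  induction t with
  | zero => rfl
  | succ t ih => simp only [run, runFrom, ih]

theorem runFrom_succ (A : ι → Lang) (c : ℕ → κ) (s : M.Cfg) (t : ℕ) :
    M.runFrom A c s (t + 1) = M.runFrom A (fun n => c (n + 1)) (M.step A (c 0) s) t := by
  induction t with
  | zero => rfl
  | succ t ih =>
    rw [runFrom, ih]
    rfl

theorem runFrom_add (A : ι → Lang) (c : ℕ → κ) (s : M.Cfg) (t u : ℕ) :
    M.runFrom A c s (t + u) = M.runFrom A (fun n => c (t + n)) (M.runFrom A c s t) u := by
  induction u with
  | zero => rfl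
  | succ u ih => rw [← add_assoc, runFrom, ih, runFrom]

variable {M}

theorem step_of_halt {A : ι → Lang} {c : κ} {s : M.Cfg} {b : Bool}
    (hs : M.instr s.state = .halt b) : M.step A c s = s := by
  simp only [step, hs]

theorem runFrom_of_halt {A : ι → Lang} {c : ℕ → κ} {s : M.Cfg} {b : Bool}
    (hs : M.instr s.state = .halt b) (t : ℕ) : M.runFrom A c s t = s := by
  induction t with
  | zero => rfl
  | succ t ih => rw [runFrom, ih, step_of_halt hs]

theorem run_of_halt {A : ι → Lang} {c : ℕ → κ} {x : List Bool} {b : Bool} {t u : ℕ} (htu : t ≤ u)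
    (hs : M.instr (M.run A c x t).state = .halt b) : M.run A c x u = M.run A c x t := by
  obtain ⟨v, rfl⟩ := Nat.exists_eq_add_of_le htu
  rw [run_eq_runFrom] at hs
  rw [run_eq_runFrom, run_eq_runFrom, runFrom_add, runFrom_of_halt hs]

theorem run_eq_run_of_halt {A : ι → Lang} {c : ℕ → κ} {x : List Bool} {b b' : Bool} {t u : ℕ}
    (ht : M.instr (M.run A c x t).state = .halt b)
    (hu : M.instr (M.run A c x u).state = .halt b') : M.run A c x t = M.run A c x u := by
  rcases le_total t u with h | h
  · exact (run_of_halt h ht).symm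
  · exact run_of_halt h hu

theorem length_step_le (A : ι → Lang) (c : κ) (s : M.Cfg) (k : M.K) :
    ((M.step A c s).stk k).length ≤ (s.stk k).length + 1 := by
  rcases hq : M.instr s.state with ⟨k', b, q'⟩ | ⟨k', next⟩ | next | ⟨S, next⟩ | b <;>
    simp only [step, hq]
  · by_cases hk : k = k' <;> simp [hk]
  · by_cases hk : k = k' <;> (simp [hk]; try lia)
  · lia
  · split_ifs <;> simp
  · lia

/-! ### Computations with verified queries -/

variable (M)

/-- If the next step of `s` is a query step, then the words queried belong to `V`. -/
def Verified (V : ι → Lang) (s : M.Cfg) : Prop :=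
  ∀ S next, M.instr s.state = .query S next → ∀ i ∈ S, s.stk (M.qry i) ∈ V i

/-- The inputs that have a halting computation whose outcome satisfies `ψ` and whose queries all
belong to `V`. -/
def verifiedLanguage (A V : ι → Lang) (ψ : Bool → Prop) : Lang :=
  {x | ∃ (c : ℕ → κ) (t : ℕ) (b : Bool), M.instr (M.run A c x t).state = .halt b ∧ ψ b ∧
    ∀ u < t, M.Verified V (M.run A c x u)}

/-- Some computation of `n` steps from `s` ends with an outcome that satisfies `ψ`, and all its
queries belong to `V`. -/
def Yields (A V : ι → Lang) (ψ : Bool → Prop) (n : ℕ) (s : M.Cfg) : Prop :=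
  ∃ (c : ℕ → κ) (b : Bool), M.instr (M.runFrom A c s n).state = .halt b ∧ ψ b ∧
    ∀ u < n, M.Verified V (M.runFrom A c s u)

/-- `M.Evaluates A V safe ψ n s φ`: all computations from `s` halt within `n` steps with a `safe`
outcome, and `φ` says that there is one whose outcome satisfies `ψ` and whose queries belong to
`V`. The proposition `φ` is an index so that a simulation can compute it along the computation
tree. -/
inductive Evaluates (A V : ι → Lang) (safe ψ : Bool → Prop) : ℕ → M.Cfg → Prop → Prop
  | halt {n : ℕ} {s : M.Cfg} {b : Bool} : M.instr s.state = .halt b → safe b →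
      Evaluates A V safe ψ n s (ψ b)
  | step {n : ℕ} {s : M.Cfg} {φ : κ → Prop} : (∀ b, M.instr s.state ≠ .halt b) →
      (∀ c, Evaluates A V safe ψ n (M.step A c s) (φ c)) →
      Evaluates A V safe ψ (n + 1) s (M.Verified V s ∧ ∃ c, φ c)

variable {M} {A V : ι → Lang} {safe ψ : Bool → Prop} {n m : ℕ} {s : M.Cfg} {x : List Bool}
  {φ : Prop}

theorem verified_univ (s : M.Cfg) : M.Verified (fun _ => Set.univ) s :=
  fun _ _ _ _ _ => Set.mem_univ _

theorem verified_of_halt {b : Bool} (hs : M.instr s.state = .halt b) : M.Verified V s := by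
  intro S next h
  rw [hs] at h
  cases h

theorem verified_iff_of_query {S : Finset ι} {next : (ι → Bool) → M.Q}
    (hs : M.instr s.state = .query S next) :
    M.Verified V s ↔ ∀ i ∈ S, s.stk (M.qry i) ∈ V i := by
  simp only [Verified, hs, Instr.query.injEq, and_imp]
  exact ⟨fun h => h S next rfl rfl, by rintro h _ _ rfl rfl; exact h⟩

theorem verified_of_not_query (hs : ∀ S next, M.instr s.state ≠ .query S next) :
    M.Verified V s :=
  fun S next h => absurd h (hs S next)

theorem language_eq_verifiedLanguage (A : ι → Lang) :
    M.language A = M.verifiedLanguage A (fun _ => Set.univ) (· = true) := by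
  ext x
  constructor
  · rintro ⟨c, t, h⟩
    exact ⟨c, t, true, h, rfl, fun _ _ => verified_univ _⟩
  · rintro ⟨c, t, b, h, rfl, -⟩
    exact ⟨c, t, h⟩

theorem yields_of_halt [Nonempty κ] {b : Bool} (hs : M.instr s.state = .halt b) :
    M.Yields A V ψ n s ↔ ψ b := by
  have hrun (c : ℕ → κ) (t : ℕ) : M.runFrom A c s t = s := runFrom_of_halt hs t
  simp only [Yields, hrun, hs]
  constructor
  · rintro ⟨_, _, ⟨⟩, h, -⟩
    exact h
  · exact fun h => ⟨Classical.arbitrary _, b, rfl, h, fun _ _ => verified_of_halt hs⟩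

theorem yields_succ :
    M.Yields A V ψ (n + 1) s ↔ M.Verified V s ∧ ∃ c, M.Yields A V ψ n (M.step A c s) := by
  constructor
  · rintro ⟨c, b, hb, hψ, hV⟩
    rw [runFrom_succ] at hb
    refine ⟨hV 0 n.succ_pos, c 0, _, b, hb, hψ, fun u hu => ?_⟩
    simpa only [runFrom_succ] using hV (u + 1) (by lia)
  · rintro ⟨h0, c, d, b, hb, hψ, hV⟩
    refine ⟨fun t => Nat.casesOn t c d, b, by rwa [runFrom_succ], hψ, fun u hu => ?_⟩
    cases u with
    | zero => exact h0
    | succ u =>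
      rw [runFrom_succ]
      exact hV u (by lia)

theorem mem_verifiedLanguage_iff_yields
    (hn : ∀ c, ∃ b, M.instr (M.run A c x n).state = .halt b) :
    x ∈ M.verifiedLanguage A V ψ ↔ M.Yields A V ψ n (M.initCfg x) := by
  simp only [Yields, ← run_eq_runFrom]
  constructor
  · rintro ⟨c, t, b, ht, hψ, hV⟩
    obtain ⟨b', hb'⟩ := hn c
    refine ⟨c, b, by rw [run_eq_run_of_halt hb' ht, ht], hψ, fun u _ => ?_⟩
    rcases lt_or_ge u t with hut | htu
    · exact hV u hut
    · rw [run_of_halt htu ht]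
      exact verified_of_halt ht
  · rintro ⟨c, b, hb, hψ, hV⟩
    exact ⟨c, n, b, hb, hψ, hV⟩

namespace Evaluates

theorem mono (h : M.Evaluates A V safe ψ n s φ) (hnm : n ≤ m) :
    M.Evaluates A V safe ψ m s φ := by
  induction h generalizing m with
  | halt hb hsafe => exact .halt hb hsafe
  | step hs _ ih =>
    obtain ⟨m, rfl⟩ := Nat.exists_eq_add_of_lt hnm
    exact .step hs fun c => ih c (by lia)

theorem of_halts [Nonempty κ] {n : ℕ} {s : M.Cfg}
    (h : ∀ c : ℕ → κ, ∃ b, M.instr (M.runFrom A c s n).state = .halt b ∧ safe b) :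
    M.Evaluates A V safe ψ n s (M.Yields A V ψ n s) := by
  induction n generalizing s with
  | zero =>
    obtain ⟨b, hb, hsafe⟩ := h (Classical.arbitrary _)
    rw [runFrom] at hb
    rw [yields_of_halt hb]
    exact .halt hb hsafe
  | succ n ih =>
    by_cases hs : ∃ b, M.instr s.state = .halt b
    · obtain ⟨b, hb⟩ := hs
      obtain ⟨b', hb', hsafe⟩ := h (Classical.arbitrary _)
      rw [runFrom_of_halt hb, hb] at hb'
      cases hb'
      rw [yields_of_halt hb]
      exact .halt hb hsafe
    · push Not at hs
      rw [yields_succ]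
      refine .step hs fun c => ih fun d => ?_
      have := h fun t => Nat.casesOn t c d
      rwa [runFrom_succ] at this

theorem sound [Nonempty κ] (h : M.Evaluates A V safe ψ n s φ) :
    (∀ c : ℕ → κ, ∃ b, M.instr (M.runFrom A c s n).state = .halt b ∧ safe b) ∧
      (φ ↔ M.Yields A V ψ n s) := by
  induction h with
  | halt hb hsafe =>
    refine ⟨fun c => ⟨_, ?_, hsafe⟩, (yields_of_halt hb).symm⟩
    rwa [runFrom_of_halt hb]
  | step _ _ ih =>
    refine ⟨fun c => ?_, ?_⟩
    · rw [runFrom_succ]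
      exact (ih (c 0)).1 _
    · rw [yields_succ]
      exact and_congr_right fun _ => exists_congr fun c => (ih c).2

end Evaluates

theorem evaluates_of_halts [Nonempty κ]
    (hn : ∀ c, ∃ b, M.instr (M.run A c x n).state = .halt b)
    (hsafe : ∀ c b, M.instr (M.run A c x n).state = .halt b → safe b) :
    M.Evaluates A V safe ψ n (M.initCfg x) (x ∈ M.verifiedLanguage A V ψ) := by
  rw [mem_verifiedLanguage_iff_yields hn]
  simp only [run_eq_runFrom] at hn hsafe
  exact .of_halts fun c => (hn c).imp fun b hb => ⟨hb, hsafe c b hb⟩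

theorem Evaluates.halts_and_mem_language_iff [Nonempty κ]
    (h : M.Evaluates A (fun _ => Set.univ) safe (· = true) n (M.initCfg x) φ) :
    (∀ c, ∃ b, M.instr (M.run A c x n).state = .halt b) ∧ (x ∈ M.language A ↔ φ) := by
  obtain ⟨hrun, hφ⟩ := h.sound
  simp only [← run_eq_runFrom] at hrun
  have hhalt (c) : ∃ b, M.instr (M.run A c x n).state = .halt b := (hrun c).imp fun _ => And.left
  exact ⟨hhalt, by rw [language_eq_verifiedLanguage, mem_verifiedLanguage_iff_yields hhalt, hφ]⟩

end OTM

/-! ### Answering queries by machines -/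

/-- The data from which the machine that answers the queries of `outer` by running the machines
`inner i` is built. -/
structure Substitution (ι ι₁ ι' κ₁ κ : Type) (κ₂ : ι → Type) where
  /-- the machine whose queries are answered -/
  outer : OTM ι κ₁
  /-- the machines that answer them -/
  inner (i : ι) : OTM ι₁ (κ₂ i)
  /-- the oracle that replaces an oracle of `inner i` -/
  oracle : ι → ι₁ → ι'
  /-- the alternative of a branching step of `outer` -/
  outerChoice : κ → κ₁
  outerChoice_surjective : outerChoice.Surjective
  /-- the alternative of a branching step of `inner i` -/
  innerChoice (i : ι) : κ → κ₂ i
  innerChoice_surjective (i : ι) : (innerChoice i).Surjective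
  /-- the answer to a query that is deduced from the outcome of `inner i`; the computation is
  given up if there is none -/
  answer : ι → Bool → Option Bool
  /-- the outcome that replaces an outcome of `outer` -/
  outcome : Bool → Bool

namespace Substitution

variable {ι ι₁ ι' κ₁ κ : Type} {κ₂ : ι → Type} (D : Substitution ι ι₁ ι' κ₁ κ κ₂)

/-- The stacks on which the inner machines work: one query stack for every oracle, and the other
stacks of the machines. -/
abbrev InnerStack := ι' ⊕ (Σ i, (D.inner i).K)

/-- The stacks of the combined machine; the last one is used to copy words. -/
abbrev Stack := D.outer.K ⊕ D.InnerStack ⊕ Unit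

noncomputable instance : DecidableEq D.InnerStack := Classical.decEq _

noncomputable instance : DecidableEq D.Stack := Classical.decEq _

open Classical in
/-- The stack that plays the role of the stack `k` of `inner i`. -/
noncomputable def embed (i : ι) (k : (D.inner i).K) : D.InnerStack :=
  if h : ∃ j, (D.inner i).qry j = k then .inl (D.oracle i h.choose) else .inr ⟨i, k⟩

theorem embed_qry [Subsingleton ι₁] (i : ι) (j : ι₁) :
    D.embed i ((D.inner i).qry j) = .inl (D.oracle i j) := by
  have h : ∃ j', (D.inner i).qry j' = (D.inner i).qry j := ⟨j, rfl⟩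
  rw [embed, dif_pos h, Subsingleton.elim h.choose j]

theorem embed_injective [Subsingleton ι₁] (i : ι) : Function.Injective (D.embed i) := by
  intro k k' hk
  by_cases h : ∃ j, (D.inner i).qry j = k <;> by_cases h' : ∃ j, (D.inner i).qry j = k'
  · obtain ⟨j, rfl⟩ := h
    obtain ⟨j', rfl⟩ := h'
    rw [Subsingleton.elim j j']
  · rw [embed, embed, dif_pos h, dif_neg h'] at hk
    cases hk
  · rw [embed, embed, dif_neg h, dif_pos h'] at hk
    cases hk
  · rw [embed, embed, dif_neg h, dif_neg h'] at hk
    cases hk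
    rfl

/-- The query step of `outer` that is being carried out: the state of `outer`, the queries that have
not been answered yet, and the answers so far. -/
abbrev Task := D.outer.Q × Finset ι × (ι → Bool)

/-- States of the combined machine. -/
inductive State
  /-- `outer` works, or the next query of a query step of `outer` is taken up -/
  | main (r : D.outer.Q ⊕ D.Task)
  /-- empty the stacks in `T` -/
  | clear (T : Finset D.Stack) (r : D.outer.Q ⊕ D.Task)
  /-- move the query to the auxiliary stack -/
  | unload (x : D.Task) (i : ι)
  | unloadPush (x : D.Task) (i : ι) (b : Bool)
  /-- move the query from the auxiliary stack to its stack and to the input stack of `inner i` -/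
  | load (x : D.Task) (i : ι)
  | loadPush (x : D.Task) (i : ι) (b : Bool)
  | loadPush' (x : D.Task) (i : ι) (b : Bool)
  /-- `inner i` works -/
  | work (x : D.Task) (i : ι) (q : (D.inner i).Q)

set_option synthInstance.maxSize 512 in
instance [Finite ι] [Finite ι'] : Finite D.State :=
  Finite.of_equiv _ (proxy_equiv% D.State)

open Classical in
/-- The stacks that have to be emptied after a query step of `outer`. -/
noncomputable def querySet (S : Finset ι) : Finset D.Stack :=
  S.image fun i => .inl (D.outer.qry i)

/-- The stacks that have to be emptied after a run of an inner machine. -/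
noncomputable def innerSet [Finite ι] [Finite ι'] : Finset D.Stack :=
  (Set.toFinite (Set.range fun k : D.InnerStack => (.inr (.inl k) : D.Stack))).toFinset

section Machine

variable [LinearOrder ι] [Finite ι] [Finite ι']

open Classical in
/-- The program of the combined machine. -/
noncomputable def program : D.State → Instr ι' κ D.Stack D.State
  | .main (.inl q) => match D.outer.instr q with
    | .push k b q' => .push (.inl k) b (.main (.inl q'))
    | .pop k next => .pop (.inl k) fun o => .main (.inl (next o))
    | .branch next => .branch fun c => .main (.inl (next (D.outerChoice c)))
    | .query S _ => .branch fun _ => .main (.inr (q, S, fun _ => false))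
    | .halt b => .halt (D.outcome b)
  | .main (.inr (q, R, a)) =>
      if h : R.Nonempty then .branch fun _ => .unload (q, R, a) (R.min' h)
      else match D.outer.instr q with
        | .query S next => .branch fun _ => .clear (D.querySet S) (.inl (next a))
        | _ => .halt false
  | .clear T r =>
      if h : T.Nonempty then .pop h.choose fun o =>
        o.elim (.clear (T.erase h.choose) r) fun _ => .clear T r
      else .branch fun _ => .main r
  | .unload x i => .pop (.inl (D.outer.qry i)) fun o => o.elim (.load x i) (.unloadPush x i)
  | .unloadPush x i b => .push (.inr (.inr ())) b (.unload x i)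
  | .load x i => .pop (.inr (.inr ())) fun o =>
      o.elim (.work x i (D.inner i).start) (.loadPush x i)
  | .loadPush x i b => .push (.inl (D.outer.qry i)) b (.loadPush' x i b)
  | .loadPush' x i b => .push (.inr (.inl (D.embed i (D.inner i).inp))) b (.load x i)
  | .work x i q => match (D.inner i).instr q with
    | .push k b q' => .push (.inr (.inl (D.embed i k))) b (.work x i q')
    | .pop k next => .pop (.inr (.inl (D.embed i k))) fun o => .work x i (next o)
    | .branch next => .branch fun c => .work x i (next (D.innerChoice i c))
    | .query S next =>
        if S.Nonempty then
          .query (S.image (D.oracle i)) fun a => .work x i (next fun j => a (D.oracle i j))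
        else .branch fun _ => .work x i (next fun _ => false)
    | .halt b => match D.answer i b with
      | none => .halt false
      | some v => .branch fun _ =>
          .clear D.innerSet (.inr (x.1, x.2.1.erase i, Function.update x.2.2 i v))

/-- The machine that answers the queries of `outer` by running the inner machines. -/
@[reducible] noncomputable def machine : OTM ι' κ where
  Q := D.State
  K := D.Stack
  start := .main (.inl D.outer.start)
  inp := .inl D.outer.inp
  qry o := .inr (.inl (.inl o))
  instr := D.program

end Machine

/-- The contents of the stacks of the combined machine: `o` on the stacks of `outer`, `w` on those
of the inner machines, and `t` on the auxiliary stack. -/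
def contents (o : D.outer.K → List Bool) (w : D.InnerStack → List Bool) (t : List Bool) :
    D.Stack → List Bool :=
  Sum.elim o (Sum.elim w fun _ => t)

/-- The contents of the stacks of the inner machines while `inner i` works with contents `s`. -/
noncomputable def embedStacks (i : ι) (s : (D.inner i).K → List Bool) :
    D.InnerStack → List Bool :=
  Function.extend (D.embed i) s fun _ => []

variable {D}

theorem embedStacks_embed [Subsingleton ι₁] (i : ι) (s : (D.inner i).K → List Bool)
    (k : (D.inner i).K) : D.embedStacks i s (D.embed i k) = s k :=
  (D.embed_injective i).extend_apply _ _ _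

theorem embedStacks_nil (i : ι) : D.embedStacks i (fun _ => []) = fun _ => [] :=
  Function.extend_const _ _

theorem length_embedStacks_le {i : ι} {s : (D.inner i).K → List Bool} {B : ℕ}
    (hs : ∀ k, (s k).length ≤ B) (k : D.InnerStack) : (D.embedStacks i s k).length ≤ B := by
  classical
  rw [embedStacks, Function.extend_def]
  split_ifs
  · exact hs _
  · exact B.zero_le

theorem update_embedStacks [Subsingleton ι₁] (i : ι)
    (s : (D.inner i).K → List Bool) (k : (D.inner i).K) (v : List Bool) :
    Function.update (D.embedStacks i s) (D.embed i k) v =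
      D.embedStacks i (Function.update s k v) := by
  funext k'
  by_cases hk' : ∃ k₀, D.embed i k₀ = k'
  · obtain ⟨k₀, rfl⟩ := hk'
    rw [embedStacks_embed]
    by_cases hk : k₀ = k
    · rw [hk, Function.update_self, Function.update_self]
    · rw [Function.update_of_ne ((D.embed_injective i).ne hk), Function.update_of_ne hk,
        embedStacks_embed]
  · have hne : k' ≠ D.embed i k := fun h => hk' ⟨k, h.symm⟩
    rw [Function.update_of_ne hne, embedStacks, embedStacks, Function.extend_apply' _ _ _ hk',
      Function.extend_apply' _ _ _ hk']

theorem update_contents_outer (o : D.outer.K → List Bool)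
    (w : D.InnerStack → List Bool) (t : List Bool) (k : D.outer.K) (v : List Bool) :
    Function.update (D.contents o w t) (.inl k) v = D.contents (Function.update o k v) w t :=
  Sum.update_elim_inl

theorem update_contents_inner (o : D.outer.K → List Bool) (w : D.InnerStack → List Bool)
    (t : List Bool) (k : D.InnerStack) (v : List Bool) :
    Function.update (D.contents o w t) (.inr (.inl k)) v =
      D.contents o (Function.update w k v) t := by
  classical
  simp only [contents, Sum.update_elim_inr, Sum.update_elim_inl]

theorem update_contents_copy (o : D.outer.K → List Bool)
    (w : D.InnerStack → List Bool) (t v : List Bool) :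
    Function.update (D.contents o w t) (.inr (.inr ())) v = D.contents o w v := by
  classical
  simp only [contents, Sum.update_elim_inr]
  congr 2

theorem mem_querySet {S : Finset ι} {k : D.Stack} :
    k ∈ D.querySet S ↔ ∃ i ∈ S, .inl (D.outer.qry i) = k := by
  simp [querySet]

variable [Finite ι] [Finite ι']

theorem mem_innerSet {k : D.Stack} : k ∈ D.innerSet ↔ ∃ k', k = .inr (.inl k') := by
  simp [innerSet, eq_comm]

theorem card_le_card_stack (T : Finset D.Stack) : T.card ≤ Nat.card D.Stack := by
  have := Fintype.ofFinite D.Stack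
  rw [Nat.card_eq_fintype_card]
  exact Finset.card_le_univ T

variable [LinearOrder ι]

section Step

variable {O : ι' → Lang} {c : κ} {q q' : D.State} {stk : D.Stack → List Bool}
  {log : List (Finset ι')}

theorem step_push {k : D.Stack} {b : Bool} (hq : D.program q = .push k b q') :
    D.machine.step O c ⟨q, stk, log⟩ =
      ⟨q', Function.update stk k (b :: stk k), log⟩ := by
  simp only [OTM.step, hq]

theorem step_pop {k : D.Stack} {next : Option Bool → D.State} (hq : D.program q = .pop k next) :
    D.machine.step O c ⟨q, stk, log⟩ =
      ⟨next (stk k).head?, Function.update stk k (stk k).tail, log⟩ := by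
  simp only [OTM.step, hq]

theorem step_branch {next : κ → D.State} (hq : D.program q = .branch next) :
    D.machine.step O c ⟨q, stk, log⟩ = ⟨next c, stk, log⟩ := by
  simp only [OTM.step, hq]

open Classical in
theorem step_query {S : Finset ι'} {next : (ι' → Bool) → D.State}
    (hq : D.program q = .query S next) :
    D.machine.step O c ⟨q, stk, log⟩ =
      ⟨next fun i => decide (i ∈ S ∧ stk (.inr (.inl (.inl i))) ∈ O i),
        fun k => if ∃ i ∈ S, .inr (.inl (.inl i)) = k then [] else stk k, log ++ [S]⟩ := by
  simp only [OTM.step, hq]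

theorem step_main_of_not_query {𝒜 : ι → Lang} {s : D.outer.Cfg}
    (hs : ∀ b, D.outer.instr s.state ≠ .halt b)
    (hquery : ∀ S next, D.outer.instr s.state ≠ .query S next) (w : D.InnerStack → List Bool)
    (t : List Bool) :
    D.machine.step O c ⟨.main (.inl s.state), D.contents s.stk w t, log⟩ =
      ⟨.main (.inl (D.outer.step 𝒜 (D.outerChoice c) s).state),
        D.contents (D.outer.step 𝒜 (D.outerChoice c) s).stk w t, log⟩ := by
  classical
  obtain ⟨q, stk, l⟩ := s
  dsimp only at hs hquery ⊢
  rcases hq : D.outer.instr q with ⟨k, b, q'⟩ | ⟨k, next⟩ | next | ⟨S, next⟩ | b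
  · rw [step_push (by simp only [program, hq]; rfl), update_contents_outer]
    simp only [OTM.step, hq, contents, Sum.elim_inl]
  · rw [step_pop (by simp only [program, hq]; rfl), update_contents_outer]
    simp only [OTM.step, hq, contents, Sum.elim_inl]
  · rw [step_branch (by simp only [program, hq]; rfl)]
    simp only [OTM.step, hq]
  · exact absurd hq (hquery _ _)
  · exact absurd hq (hs b)

variable [Subsingleton ι₁] {x : D.Task} {i : ι} {o : D.outer.K → List Bool} {t : List Bool}

open Classical in
theorem step_work_query {s : (D.inner i).Cfg} {S : Finset ι₁}
    {next : (ι₁ → Bool) → (D.inner i).Q} (hq : (D.inner i).instr s.state = .query S next)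
    (hS : S.Nonempty) (c' : κ₂ i) :
    D.machine.step O c ⟨.work x i s.state, D.contents o (D.embedStacks i s.stk) t, log⟩ =
      ⟨.work x i ((D.inner i).step (fun j => O (D.oracle i j)) c' s).state,
        D.contents o (D.embedStacks i ((D.inner i).step (fun j => O (D.oracle i j)) c' s).stk) t,
        log ++ [S.image (D.oracle i)]⟩ := by
  have hmem (j : ι₁) : D.oracle i j ∈ S.image (D.oracle i) ↔ j ∈ S := by
    refine ⟨fun h => ?_, Finset.mem_image_of_mem _⟩
    obtain ⟨j', hj', -⟩ := Finset.mem_image.1 h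
    rwa [Subsingleton.elim j j']
  rw [step_query (by simp only [program, hq, if_pos hS]; rfl)]
  simp only [OTM.step, hq]
  congr 1
  · congr 2
    funext j
    simp only [hmem, contents, Sum.elim_inr, Sum.elim_inl, ← D.embed_qry, embedStacks_embed]
  · funext k
    rcases k with k | k | k
    · simp [contents]
    · simp only [contents, Sum.elim_inr, Sum.elim_inl]
      by_cases hk : ∃ k', D.embed i k' = k
      · obtain ⟨k', rfl⟩ := hk
        simp only [embedStacks_embed, Finset.exists_mem_image, ← D.embed_qry, Sum.inr.injEq,
          Sum.inl.injEq, (D.embed_injective i).eq_iff]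
      · simp only [embedStacks, Function.extend_apply' _ _ _ hk, ite_self]
    · simp [contents]

theorem step_work {s : (D.inner i).Cfg} (hs : ∀ b, (D.inner i).instr s.state ≠ .halt b) :
    ∃ log',
      D.machine.step O c ⟨.work x i s.state, D.contents o (D.embedStacks i s.stk) t, log⟩ =
        ⟨.work x i ((D.inner i).step (fun j => O (D.oracle i j)) (D.innerChoice i c) s).state,
          D.contents o (D.embedStacks i
            ((D.inner i).step (fun j => O (D.oracle i j)) (D.innerChoice i c) s).stk) t,
          log'⟩ := by
  classical
  rcases hq : (D.inner i).instr s.state with ⟨k, b, q'⟩ | ⟨k, next⟩ | next | ⟨S, next⟩ | b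
  · refine ⟨log, ?_⟩
    rw [step_push (by simp only [program, hq]; rfl), update_contents_inner, update_embedStacks]
    simp only [OTM.step, hq, contents, Sum.elim_inr, Sum.elim_inl, embedStacks_embed]
  · refine ⟨log, ?_⟩
    rw [step_pop (by simp only [program, hq]; rfl), update_contents_inner, update_embedStacks]
    simp only [OTM.step, hq, contents, Sum.elim_inr, Sum.elim_inl, embedStacks_embed]
  · refine ⟨log, ?_⟩
    rw [step_branch (by simp only [program, hq]; rfl)]
    simp only [OTM.step, hq]
  · rcases S.eq_empty_or_nonempty with rfl | hS
    · refine ⟨log, ?_⟩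
      rw [step_branch (by simp only [program, hq, Finset.not_nonempty_empty, if_false]; rfl)]
      simp [OTM.step, hq]
    · exact ⟨_, step_work_query hq hS _⟩
  · exact absurd hq (hs b)

end Step

/-- The configurations of the combined machine with the given state and stacks are evaluated within
`n` steps. -/
def Decides (D : Substitution ι ι₁ ι' κ₁ κ κ₂) (O : ι' → Lang) (n : ℕ) (q : D.State)
    (stk : D.Stack → List Bool) (φ : Prop) : Prop :=
  ∀ log, D.machine.Evaluates O (fun _ => Set.univ) (fun _ => True) (· = true) n ⟨q, stk, log⟩ φ

/-- All computations of `D.inner i` from `s` halt within `m` steps, no answer but `v` is deduced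
from their outcomes, and `φ` says that some outcome yields an answer. -/
def Answers (D : Substitution ι ι₁ ι' κ₁ κ κ₂) (O : ι' → Lang) (i : ι) (m : ℕ)
    (s : (D.inner i).Cfg) (v : Bool) (φ : Prop) : Prop :=
  (D.inner i).Evaluates (fun j => O (D.oracle i j)) (fun _ => Set.univ)
    (fun b => ∀ a, D.answer i b = some a → a = v) (fun b => ∃ a, D.answer i b = some a) m s φ

open Classical in
/-- The queries of length at most `L` are answered within `m` steps according to the languages
`𝒜 i`, and `V i` consists of the queries that are answered on some computation. -/
def AnswersAll (D : Substitution ι ι₁ ι' κ₁ κ κ₂) (O : ι' → Lang) (L m : ℕ) (𝒜 V : ι → Lang) :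
    Prop :=
  ∀ i (l : List Bool), l.length ≤ L →
    D.Answers O i m ((D.inner i).initCfg l) (decide (l ∈ 𝒜 i)) (l ∈ V i)

/-- A bound for the time taken by a query of length at most `L` to a machine that takes time `m`. -/
noncomputable def answerTime (D : Substitution ι ι₁ ι' κ₁ κ κ₂) (L m : ℕ) : ℕ :=
  5 * L + m + Nat.card D.Stack * (L + m + 1) + 5

/-- A bound for the time taken to simulate one step of the outer machine if the words on its stacks
have length at most `L` and the inner machines take time `m`. -/
noncomputable def stepTime (D : Substitution ι ι₁ ι' κ₁ κ κ₂) (L m : ℕ) : ℕ :=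
  Nat.card ι * D.answerTime L m + Nat.card D.Stack * (L + 1) + 3

theorem program_work_ne_halt {x : D.Task} {i : ι} {q : (D.inner i).Q}
    (hq : ∀ b, (D.inner i).instr q ≠ .halt b) (b : Bool) : D.program (.work x i q) ≠ .halt b := by
  intro hb
  simp only [program] at hb
  rcases hq' : (D.inner i).instr q with ⟨k, b', q'⟩ | ⟨k, next⟩ | next | ⟨S, next⟩ | b' <;>
    simp only [hq', reduceCtorEq] at hb
  · split_ifs at hb
  · exact hq _ hq'

theorem program_main_ne_halt {q : D.outer.Q} (hq : ∀ b, D.outer.instr q ≠ .halt b) (b : Bool) :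
    D.program (.main (.inl q)) ≠ .halt b := by
  intro hb
  simp only [program] at hb
  rcases hq' : D.outer.instr q with ⟨k, b', q'⟩ | ⟨k, next⟩ | next | ⟨S, next⟩ | b' <;>
    simp only [hq', reduceCtorEq] at hb
  exact hq _ hq'

namespace Decides

variable {O : ι' → Lang} {n m : ℕ} {q q' : D.State} {stk : D.Stack → List Bool} {φ : Prop}

theorem mono (h : D.Decides O n q stk φ) (hnm : n ≤ m) : D.Decides O m q stk φ :=
  fun log => (h log).mono hnm

theorem halt {b : Bool} (hq : D.program q = .halt b) : D.Decides O n q stk (b = true) :=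
  fun _ => .halt hq trivial

theorem step {q' : κ → D.State} {stk' : κ → D.Stack → List Bool} {φ : κ → Prop}
    (hq : ∀ b, D.program q ≠ .halt b)
    (hstep : ∀ c log, ∃ log', D.machine.step O c ⟨q, stk, log⟩ = ⟨q' c, stk' c, log'⟩)
    (h : ∀ c, D.Decides O n (q' c) (stk' c) (φ c)) :
    D.Decides O (n + 1) q stk (∃ c, φ c) := by
  intro log
  have key := OTM.Evaluates.step (M := D.machine) (A := O) (V := fun _ => Set.univ)
    (safe := fun _ => True) (ψ := (· = true)) (n := n) (s := ⟨q, stk, log⟩) hq fun c => by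
      obtain ⟨log', hlog'⟩ := hstep c log
      rw [hlog']
      exact h c log'
  simpa only [OTM.verified_univ, true_and] using key

theorem main_of_not_query {𝒜 : ι → Lang} {s : D.outer.Cfg} {φ : κ₁ → Prop}
    (hs : ∀ b, D.outer.instr s.state ≠ .halt b)
    (hquery : ∀ S next, D.outer.instr s.state ≠ .query S next)
    (h : ∀ c, D.Decides O n (.main (.inl (D.outer.step 𝒜 c s).state))
      (D.contents (D.outer.step 𝒜 c s).stk (fun _ => []) []) (φ c)) :
    D.Decides O (n + 1) (.main (.inl s.state)) (D.contents s.stk (fun _ => []) []) (∃ c, φ c) := by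
  rw [D.outerChoice_surjective.exists]
  exact step (program_main_ne_halt hs)
    (fun c log => ⟨log, step_main_of_not_query hs hquery _ _⟩) fun c => h (D.outerChoice c)

variable [Nonempty κ]

theorem goto (hq : D.program q = .branch fun _ => q') (h : D.Decides O n q' stk φ) :
    D.Decides O (n + 1) q stk φ := by
  simpa using step (φ := fun _ : κ => φ) (by simp [hq]) (fun c log => ⟨log, step_branch hq⟩)
    fun _ => h

theorem push {k : D.Stack} {b : Bool} (hq : D.program q = .push k b q')
    (h : D.Decides O n q' (Function.update stk k (b :: stk k)) φ) :
    D.Decides O (n + 1) q stk φ := by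
  simpa using step (φ := fun _ : κ => φ) (by simp [hq]) (fun c log => ⟨log, step_push hq⟩)
    fun _ => h

theorem pop {k : D.Stack} {next : Option Bool → D.State} (hq : D.program q = .pop k next)
    (h : D.Decides O n (next (stk k).head?) (Function.update stk k (stk k).tail) φ) :
    D.Decides O (n + 1) q stk φ := by
  simpa using step (φ := fun _ : κ => φ) (by simp [hq]) (fun c log => ⟨log, step_pop hq⟩)
    fun _ => h

theorem clear_choose {T : Finset D.Stack} (hT : T.Nonempty) {r : D.outer.Q ⊕ D.Task}
    {l : List Bool} (hl : stk hT.choose = l)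
    (h : D.Decides O n (.clear (T.erase hT.choose) r) (Function.update stk hT.choose []) φ) :
    D.Decides O (n + l.length + 1) (.clear T r) stk φ := by
  have hq : D.program (.clear T r) = .pop hT.choose fun o =>
    o.elim (.clear (T.erase hT.choose) r) fun _ => .clear T r := by rw [program, dif_pos hT]
  induction l generalizing stk with
  | nil => exact pop hq (by rw [hl]; exact h)
  | cons b l ih =>
    refine pop hq ?_
    rw [hl]
    exact ih (Function.update_self ..) (by rwa [Function.update_idem])

open Classical in
theorem clear {T : Finset D.Stack} {r : D.outer.Q ⊕ D.Task} {B : ℕ}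
    (hB : ∀ k ∈ T, (stk k).length ≤ B)
    (h : D.Decides O n (.main r) (fun k => if k ∈ T then [] else stk k) φ) :
    D.Decides O (n + T.card * (B + 1) + 1) (.clear T r) stk φ := by
  induction hT : T.card generalizing T stk with
  | zero =>
    obtain rfl := Finset.card_eq_zero.1 hT
    refine mono (goto (q' := .main r) ?_ (by simpa using h)) (by lia)
    rw [program, dif_neg Finset.not_nonempty_empty]
  | succ t ih =>
    have hne : T.Nonempty := Finset.card_pos.1 (by lia)
    have hmem := hne.choose_spec
    have hlength := hB _ hmem
    refine mono (clear_choose hne rfl (ih (T := T.erase hne.choose) ?_ ?_ ?_))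
      (m := n + (t + 1) * (B + 1) + 1) (by lia)
    · intro k hk
      rw [Function.update_of_ne (Finset.ne_of_mem_erase hk)]
      exact hB k (Finset.mem_of_mem_erase hk)
    · convert h using 2 with k
      by_cases hk : k = hne.choose
      · simp [hk, hmem]
      · simp [hk]
    · rw [Finset.card_erase_of_mem hmem, hT, Nat.add_sub_cancel]

variable {x : D.Task} {i : ι} {o : D.outer.K → List Bool} {w : D.InnerStack → List Bool}
  {t l : List Bool}

theorem unload (hl : o (D.outer.qry i) = l)
    (h : D.Decides O n (.load x i)
      (D.contents (Function.update o (D.outer.qry i) []) w (l.reverse ++ t)) φ) :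
    D.Decides O (n + 2 * l.length + 1) (.unload x i) (D.contents o w t) φ := by
  induction l generalizing o t with
  | nil =>
    refine pop (by rw [program]) ?_
    rw [update_contents_outer, show D.contents o w t (.inl (D.outer.qry i)) = [] from hl]
    simpa using h
  | cons b l ih =>
    refine (pop (by rw [program]) (n := n + 2 * l.length + 1 + 1) ?_).mono
      (by rw [List.length_cons]; lia)
    rw [update_contents_outer, show D.contents o w t (.inl (D.outer.qry i)) = b :: l from hl]
    refine push (by rw [List.head?_cons, Option.elim_some, program]) ?_
    rw [update_contents_copy]
    refine ih (Function.update_self ..) ?_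
    rw [Function.update_idem]
    simpa only [contents, Sum.elim_inr, List.reverse_cons, List.append_assoc,
      List.singleton_append] using h

theorem load [Subsingleton ι₁] {s : (D.inner i).K → List Bool}
    (h : D.Decides O n (.work x i (D.inner i).start)
      (D.contents (Function.update o (D.outer.qry i) (t.reverse ++ o (D.outer.qry i)))
        (D.embedStacks i
          (Function.update s (D.inner i).inp (t.reverse ++ s (D.inner i).inp))) []) φ) :
    D.Decides O (n + 3 * t.length + 1) (.load x i) (D.contents o (D.embedStacks i s) t) φ := by
  induction t generalizing o s with
  | nil =>
    refine pop (by rw [program]) ?_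
    rw [update_contents_copy]
    simpa [contents] using h
  | cons b t ih =>
    refine (pop (by rw [program]) (n := n + 3 * t.length + 1 + 1 + 1) ?_).mono
      (by rw [List.length_cons]; lia)
    rw [update_contents_copy]
    refine push (q' := .loadPush' x i b) (k := .inl (D.outer.qry i)) (b := b)
      (by simp only [contents, Sum.elim_inr, List.head?_cons, Option.elim_some, program]) ?_
    rw [update_contents_outer]
    refine push (by rw [program]) ?_
    rw [update_contents_inner, update_embedStacks]
    refine ih ?_
    simpa only [contents, Sum.elim_inl, Sum.elim_inr, embedStacks_embed, Function.update_self,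
      Function.update_idem, List.tail_cons, List.reverse_cons, List.append_assoc,
      List.singleton_append] using h

open Classical in
theorem resume {q : D.outer.Q} {S : Finset ι} {next : (ι → Bool) → D.outer.Q}
    (hq : D.outer.instr q = .query S next) {a : ι → Bool} {L : ℕ} (hL : ∀ k, (o k).length ≤ L)
    (h : D.Decides O n (.main (.inl (next a)))
      (D.contents (fun k => if ∃ i ∈ S, D.outer.qry i = k then [] else o k) (fun _ => []) []) φ) :
    D.Decides O (n + Nat.card D.Stack * (L + 1) + 2) (.main (.inr (q, ∅, a)))
      (D.contents o (fun _ => []) []) φ := by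
  have hclear := clear (T := D.querySet S) (r := .inl (next a)) (B := L) (O := O)
    (stk := D.contents o (fun _ => []) []) (φ := φ) (n := n)
    (fun k hk => by
      obtain ⟨i, -, rfl⟩ := mem_querySet.1 hk
      exact hL _)
    (by
      convert h using 2 with k
      rcases k with k | k | k <;> simp [contents, mem_querySet])
  refine (goto ?_ hclear).mono ?_
  · rw [program, dif_neg Finset.not_nonempty_empty]
    simp only [hq]
  · have := Nat.mul_le_mul_right (L + 1) (card_le_card_stack (D := D) (D.querySet S))
    lia

variable {Φ : Prop} [Subsingleton ι₁]

theorem work {v : Bool} {s : (D.inner i).Cfg} {B : ℕ} (h : D.Answers O i m s v φ)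
    (hB : ∀ k, (s.stk k).length + m ≤ B)
    (hafter : ∀ w, (∀ k, (w k).length ≤ B) →
      D.Decides O n (.clear D.innerSet (.inr (x.1, x.2.1.erase i, Function.update x.2.2 i v)))
        (D.contents o (D.embedStacks i w) []) Φ) :
    D.Decides O (n + m + 1) (.work x i s.state) (D.contents o (D.embedStacks i s.stk) [])
      (φ ∧ Φ) := by
  unfold Answers at h
  induction h with
  | @halt m s b hb hsafe =>
    rcases ha : D.answer i b with _ | a
    · simpa using halt (b := false) (by simp only [program, hb, ha])
    · obtain rfl := hsafe a ha
      simp only [Option.some.injEq, exists_eq', true_and]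
      refine (goto ?_ (hafter s.stk fun k => (hB k).trans' (by lia))).mono (by lia)
      simp only [program, hb, ha]
  | @step m s φ hs _ ih =>
    have key := step (program_work_ne_halt hs) (fun c log => step_work (c := c) (log := log) hs)
      fun c => ih (D.innerChoice i c) fun k => by
        have := OTM.length_step_le (fun j => O (D.oracle i j)) (D.innerChoice i c) s k
        have := hB k
        lia
    simpa only [OTM.verified_univ, true_and, exists_and_right,
      (D.innerChoice_surjective i).exists, ← add_assoc, add_right_comm n m 1] using key

theorem answer {q : D.outer.Q} {R : Finset ι} {a : ι → Bool} {v : Bool} {L : ℕ} (hR : R.Nonempty)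
    (hi : R.min' hR = i) (hL : (o (D.outer.qry i)).length ≤ L)
    (hv : D.Answers O i m ((D.inner i).initCfg (o (D.outer.qry i))) v φ)
    (h : D.Decides O n (.main (.inr (q, R.erase i, Function.update a i v)))
      (D.contents o (fun _ => []) []) Φ) :
    D.Decides O (n + D.answerTime L m) (.main (.inr (q, R, a))) (D.contents o (fun _ => []) [])
      (φ ∧ Φ) := by
  classical
  have hclear (w : (D.inner i).K → List Bool) (hw : ∀ k, (w k).length ≤ L + m) :
      D.Decides O (n + D.innerSet.card * (L + m + 1) + 1)
        (.clear D.innerSet (.inr (q, R.erase i, Function.update a i v)))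
        (D.contents o (D.embedStacks i w) []) Φ := by
    refine clear (fun k hk => ?_) ?_
    · obtain ⟨k', rfl⟩ := mem_innerSet.1 hk
      exact length_embedStacks_le hw k'
    · convert h using 2 with k
      rcases k with k | k | k <;> simp [contents, mem_innerSet]
  have hwork := work (x := (q, R, a)) (B := L + m) hv
    (fun k => by
      by_cases hk : k = (D.inner i).inp
      · simpa [OTM.initCfg, hk] using hL
      · simp [OTM.initCfg, hk]) hclear
  have hload := load (t := (o (D.outer.qry i)).reverse) (s := fun _ => [])
    (o := Function.update o (D.outer.qry i) []) (x := (q, R, a)) (i := i)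
    (by simpa [OTM.initCfg] using hwork)
  have hunload := unload (x := (q, R, a)) (i := i) (w := fun _ => []) (t := []) (o := o) rfl
    (by simpa [embedStacks_nil] using hload)
  refine (goto (q := .main (.inr (q, R, a))) (by rw [program, dif_pos hR, hi]) hunload).mono ?_
  have := Nat.mul_le_mul_right (L + m + 1) (card_le_card_stack (D := D) D.innerSet)
  simp only [answerTime, List.length_reverse] at *
  lia

open Classical in
theorem answers {𝒜 V : ι → Lang} {q : D.outer.Q} {S : Finset ι}
    {next : (ι → Bool) → D.outer.Q} (hq : D.outer.instr q = .query S next) {L : ℕ}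
    (hL : ∀ k, (o k).length ≤ L)
    (hv : D.AnswersAll O L m 𝒜 V)
    (h : D.Decides O n (.main (.inl (next fun i => decide (i ∈ S ∧ o (D.outer.qry i) ∈ 𝒜 i))))
      (D.contents (fun k => if ∃ i ∈ S, D.outer.qry i = k then [] else o k) (fun _ => []) []) Φ)
    {R : Finset ι} {a : ι → Bool} (hRS : R ⊆ S)
    (ha : ∀ i ∉ R, a i = decide (i ∈ S ∧ o (D.outer.qry i) ∈ 𝒜 i)) :
    D.Decides O (n + R.card * D.answerTime L m + Nat.card D.Stack * (L + 1) + 2)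
      (.main (.inr (q, R, a))) (D.contents o (fun _ => []) [])
      ((∀ i ∈ R, o (D.outer.qry i) ∈ V i) ∧ Φ) := by
  induction hc : R.card generalizing R a with
  | zero =>
    obtain rfl := Finset.card_eq_zero.1 hc
    obtain rfl : a = _ := funext fun i => ha i (Finset.notMem_empty i)
    simpa using resume hq hL h
  | succ r ih =>
    have hR : R.Nonempty := Finset.card_pos.1 (by lia)
    obtain ⟨i, hi⟩ : ∃ i, R.min' hR = i := ⟨_, rfl⟩
    have hiR : i ∈ R := hi ▸ R.min'_mem hR
    have hrest := ih (R := R.erase i)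
      (a := Function.update a i (decide (o (D.outer.qry i) ∈ 𝒜 i)))
      ((R.erase_subset _).trans hRS)
      (fun j hj => by
        rcases eq_or_ne j i with rfl | hji
        · simp [hRS hiR]
        · rw [Function.update_of_ne hji]
          exact ha j fun h => hj (Finset.mem_erase.2 ⟨hji, h⟩))
      (by rw [Finset.card_erase_of_mem hiR, hc, Nat.add_sub_cancel])
    rw [← Finset.insert_erase hiR, Finset.forall_mem_insert, and_assoc,
      Finset.insert_erase hiR]
    exact (answer hR hi (hL _) (hv _ _ (hL _)) hrest).mono (by lia)

theorem main_query {𝒜 V : ι → Lang} {L : ℕ} {s : D.outer.Cfg} {φ : κ₁ → Prop} {S : Finset ι}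
    {next : (ι → Bool) → D.outer.Q} (hq : D.outer.instr s.state = .query S next)
    (hL : ∀ k, (s.stk k).length ≤ L) (hv : D.AnswersAll O L m 𝒜 V)
    (h : ∀ c, D.Decides O n (.main (.inl (D.outer.step 𝒜 c s).state))
      (D.contents (D.outer.step 𝒜 c s).stk (fun _ => []) []) (φ c)) :
    D.Decides O (n + D.stepTime L m) (.main (.inl s.state)) (D.contents s.stk (fun _ => []) [])
      (D.outer.Verified V s ∧ ∃ c, φ c) := by
  have hanswers (c : κ) := answers (𝒜 := 𝒜) (Φ := φ (D.outerChoice c)) hq hL hv (by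
      have hc := h (D.outerChoice c)
      simp only [OTM.step, hq] at hc
      convert hc)
    (R := S) (a := fun _ => false) subset_rfl fun i hi => by simp [hi]
  have key := step (q := .main (.inl s.state)) (program_main_ne_halt (by simp [hq]))
    (fun c log => ⟨log, step_branch (by simp only [program, hq]; rfl)⟩) hanswers
  rw [OTM.verified_iff_of_query hq, D.outerChoice_surjective.exists, ← exists_and_left]
  have := Fintype.ofFinite ι
  have := Nat.mul_le_mul_right (D.answerTime L m) S.card_le_univ
  refine key.mono ?_
  rw [stepTime, Nat.card_eq_fintype_card (α := ι)]
  lia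

theorem main {𝒜 V : ι → Lang} {safe : Bool → Prop} {L : ℕ} {s : D.outer.Cfg}
    (h : D.outer.Evaluates 𝒜 V safe (fun b => D.outcome b = true) n s φ)
    (hL : ∀ k, (s.stk k).length + n ≤ L) (hv : D.AnswersAll O L m 𝒜 V) :
    D.Decides O (n * D.stepTime L m) (.main (.inl s.state)) (D.contents s.stk (fun _ => []) [])
      φ := by
  induction h with
  | halt hb _ => exact halt (b := D.outcome _) (by simp only [program, hb])
  | @step n s φ hs _ ih =>
    have hrest (c) := ih c fun k => by
      have := OTM.length_step_le 𝒜 c s k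
      have := hL k
      lia
    rw [add_one_mul]
    by_cases hquery : ∃ S next, D.outer.instr s.state = .query S next
    · obtain ⟨S, next, hq⟩ := hquery
      exact main_query hq (fun k => (hL k).trans' (by lia)) hv hrest
    · push Not at hquery
      rw [and_iff_right (OTM.verified_of_not_query hquery)]
      exact (main_of_not_query hs hquery hrest).mono (by rw [stepTime]; lia)

end Decides

end Substitution

theorem monotone_eval_nat (p : Polynomial ℕ) : Monotone fun n => p.eval n := by
  intro a b hab
  simp only [Polynomial.eval_eq_sum_range]
  gcongr

namespace OTM

/-- The answers deduced by `answer` from the outcomes of `N` with oracles `A` agree with `B`. -/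
def AnswersCorrectly {ι κ : Type} (N : OTM ι κ) (answer : Bool → Option Bool) (A : ι → Lang)
    (B : Lang) : Prop :=
  ∀ x c t b a, N.instr (N.run A c x t).state = .halt b → answer b = some a → (a = true ↔ x ∈ B)

/-- The words for which some computation of `N` with oracles `A` gives an answer. -/
def answered {ι κ : Type} (N : OTM ι κ) (answer : Bool → Option Bool) (A : ι → Lang) : Lang :=
  N.verifiedLanguage A (fun _ => Set.univ) fun b => ∃ a, answer b = some a

end OTM

namespace Substitution

variable {ι ι₁ ι' κ₁ κ : Type} {κ₂ : ι → Type} {D : Substitution ι ι₁ ι' κ₁ κ κ₂}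

/-- A word is accepted if some computation of `D.outer` has an outcome that is replaced by `true`,
and its queries are all answered on some computation of the inner machines. -/
def acceptedLanguage (D : Substitution ι ι₁ ι' κ₁ κ κ₂) (O : ι' → Lang) (𝒜 : ι → Lang) : Lang :=
  D.outer.verifiedLanguage 𝒜
    (fun i => (D.inner i).answered (D.answer i) fun j => O (D.oracle i j))
    fun b => D.outcome b = true

variable [Finite ι] [Nonempty κ]

open Classical in
theorem exists_answersAll (hN : ∀ i, (D.inner i).PolyTime) :
    ∃ m : Polynomial ℕ, ∀ (O : ι' → Lang) (𝒜 : ι → Lang),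
      (∀ i, (D.inner i).AnswersCorrectly (D.answer i) (fun j => O (D.oracle i j)) (𝒜 i)) →
      ∀ L, D.AnswersAll O L (m.eval L) 𝒜
        fun i => (D.inner i).answered (D.answer i) fun j => O (D.oracle i j) := by
  have := Fintype.ofFinite ι
  have (i : ι) : Nonempty (κ₂ i) := Nonempty.map (D.innerChoice i) inferInstance
  choose q hq using hN
  refine ⟨∑ i, q i, fun O 𝒜 h L i l hl => ?_⟩
  refine (OTM.evaluates_of_halts (hq i _ · l) fun c b hb a ha => ?_).mono ?_
  · exact Bool.eq_iff_iff.2 ((h i l c _ b a hb ha).trans decide_eq_true_iff.symm)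
  · rw [Polynomial.eval_finsetSum]
    exact (monotone_eval_nat (q i) hl).trans
      (Finset.single_le_sum (f := fun i => (q i).eval L) (by simp) (Finset.mem_univ i))

variable [LinearOrder ι] [Finite ι'] [Subsingleton ι₁]

theorem exists_machine_evaluates (hM : D.outer.PolyTime) (hN : ∀ i, (D.inner i).PolyTime) :
    ∃ p : Polynomial ℕ, ∀ (O : ι' → Lang) (𝒜 : ι → Lang),
      (∀ i, (D.inner i).AnswersCorrectly (D.answer i) (fun j => O (D.oracle i j)) (𝒜 i)) →
      ∀ x : List Bool, D.machine.Evaluates O (fun _ => Set.univ) (fun _ => True) (· = true)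
        (p.eval x.length) (D.machine.initCfg x) (x ∈ D.acceptedLanguage O 𝒜) := by
  have : Nonempty κ₁ := Nonempty.map D.outerChoice inferInstance
  obtain ⟨p, hp⟩ := hM
  obtain ⟨m, hm⟩ := exists_answersAll hN
  let L : Polynomial ℕ := .X + p
  refine ⟨p * (.C (Nat.card ι) *
      (5 * L + m.comp L + .C (Nat.card D.Stack) * (L + m.comp L + 1) + 5) +
    .C (Nat.card D.Stack) * (L + 1) + 3), fun O 𝒜 h x => ?_⟩
  have hstk (k : D.outer.K) :
      ((D.outer.initCfg x).stk k).length + p.eval x.length ≤ L.eval x.length := by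
    by_cases hk : k = D.outer.inp <;> simp [OTM.initCfg, hk, L]
  have houter := OTM.evaluates_of_halts
    (V := fun i => (D.inner i).answered (D.answer i) fun j => O (D.oracle i j))
    (safe := fun _ => True) (ψ := fun b => D.outcome b = true) (fun c => hp 𝒜 c x)
    (fun _ _ _ => trivial)
  have hinit : (D.machine.initCfg x).stk =
      D.contents (D.outer.initCfg x).stk (fun _ => []) [] := by
    simp only [OTM.initCfg]
    convert update_contents_outer (D := D) (fun _ => []) (fun _ => []) [] D.outer.inp x using 2
    funext k
    rcases k with _ | _ | _ <;> rfl
  have key := Decides.main houter hstk (hm O 𝒜 h _) []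
  rw [← hinit] at key
  convert key using 1
  · simp [stepTime, answerTime]
  · rfl
  · rfl

theorem machine_polyTime (hM : D.outer.PolyTime) (hN : ∀ i, (D.inner i).PolyTime)
    (h : ∀ i (A : ι₁ → Lang), ∃ B, (D.inner i).AnswersCorrectly (D.answer i) A B) :
    D.machine.PolyTime := by
  obtain ⟨p, hp⟩ := exists_machine_evaluates hM hN
  choose B hB using h
  exact ⟨p, fun O c x => (hp O (fun i => B i _) (fun i => hB i _) x).halts_and_mem_language_iff.1 c⟩

theorem machine_language (hM : D.outer.PolyTime) (hN : ∀ i, (D.inner i).PolyTime)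
    {O : ι' → Lang} {𝒜 : ι → Lang}
    (h : ∀ i, (D.inner i).AnswersCorrectly (D.answer i) (fun j => O (D.oracle i j)) (𝒜 i)) :
    D.machine.language O = D.acceptedLanguage O 𝒜 := by
  obtain ⟨p, hp⟩ := exists_machine_evaluates hM hN
  ext x
  exact (hp O 𝒜 h x).halts_and_mem_language_iff.2

end Substitution

/-- The disjoint union of two languages. -/
def join (A : Bool → Lang) : Lang :=
  {x | ∃ b w, x = b :: w ∧ w ∈ A b}

theorem nil_notMem_join (A : Bool → Lang) : [] ∉ join A := by
  simp [join]

theorem cons_mem_join {A : Bool → Lang} {b : Bool} {w : List Bool} :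
    b :: w ∈ join A ↔ w ∈ A b := by
  simp only [join, Set.mem_ofPred_eq, List.cons.injEq]
  exact ⟨by rintro ⟨_, _, ⟨rfl, rfl⟩, h⟩; exact h, fun h => ⟨b, w, ⟨rfl, rfl⟩, h⟩⟩

namespace OTM

variable {ι κ : Type} {M : OTM ι κ}

theorem polyTime_of_halts {n : ℕ}
    (hn : ∀ A c x, ∃ b, M.instr (M.run A c x n).state = .halt b) : M.PolyTime :=
  ⟨n, fun A c x => by simpa using hn A c x⟩

theorem answersCorrectly_some (N : DTM ι) (A : ι → Lang) :
    N.AnswersCorrectly some A (N.language A) := by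
  rintro x c t b a hb ⟨⟩
  constructor
  · rintro rfl
    exact ⟨c, t, hb⟩
  · rintro ⟨d, u, hu⟩
    obtain rfl : d = c := Subsingleton.elim _ _
    rw [run_eq_run_of_halt hb hu, hu] at hb
    cases hb
    rfl

theorem answered_some [Nonempty κ] (hM : M.PolyTime) (A : ι → Lang) :
    M.answered some A = Set.univ := by
  obtain ⟨p, hp⟩ := hM
  refine Set.eq_univ_of_forall fun x => ?_
  let c : ℕ → κ := fun _ => Classical.arbitrary κ
  obtain ⟨b, hb⟩ := hp A c x
  exact ⟨c, _, b, hb, ⟨b, rfl⟩, fun _ _ => verified_univ _⟩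

/-! ### Small machines -/

/-- The machine that queries the oracles in `S` about its input, and halts. -/
def ask (κ : Type) (S : Finset ι) (decision : (ι → Bool) → Bool) : OTM ι κ where
  Q := Option Bool
  K := Unit
  start := none
  inp := ()
  qry _ := ()
  instr
    | none => .query S fun a => some (decision a)
    | some b => .halt b

/-- The machine that pops a bit and queries the corresponding oracle about the rest of the input. -/
def popAsk : DTM Bool where
  Q := Option (Bool ⊕ Bool)
  K := Unit
  start := none
  inp := ()
  qry _ := ()
  instr
    | none => .pop () fun o => some (o.elim (.inr false) .inl)
    | some (.inl b) => .query {b} fun a => some (.inr (a b))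
    | some (.inr b) => .halt b

/-- The machine that guesses a bit and queries the corresponding oracle about its input. -/
def guessAsk : NTM Bool where
  Q := Option (Bool ⊕ Bool)
  K := Unit
  start := none
  inp := ()
  qry _ := ()
  instr
    | none => .branch fun b => some (.inl b)
    | some (.inl b) => .query {b} fun a => some (.inr (a b))
    | some (.inr b) => .halt b

/-- The machine that queries its oracle about its input prefixed by `b`. -/
def tagAsk (b : Bool) : DTM Unit where
  Q := Option (Option Bool)
  K := Unit
  start := none
  inp := ()
  qry _ := ()
  instr
    | none => .push () b (some none)
    | some none => .query {()} fun a => some (some (a ()))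
    | some (some b) => .halt b

theorem polyTime_ask (S : Finset ι) (decision : (ι → Bool) → Bool) : (ask κ S decision).PolyTime :=
  polyTime_of_halts (n := 1) fun _ _ _ => ⟨_, rfl⟩

theorem popAsk_halts (A : Bool → Lang) (c : ℕ → Unit) (x : List Bool) :
    ∃ b, popAsk.instr (popAsk.run A c x 2).state = .halt b := by
  cases x <;> exact ⟨_, rfl⟩

theorem polyTime_popAsk : popAsk.PolyTime :=
  polyTime_of_halts popAsk_halts

theorem polyTime_guessAsk : guessAsk.PolyTime :=
  polyTime_of_halts (n := 2) fun _ _ _ => ⟨_, rfl⟩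

theorem polyTime_tagAsk (b : Bool) : (tagAsk b).PolyTime :=
  polyTime_of_halts (n := 2) fun _ _ _ => ⟨_, rfl⟩

open Classical in
theorem verifiedLanguage_ask [Nonempty κ] (S : Finset ι) (decision : (ι → Bool) → Bool)
    (A V : ι → Lang) (ψ : Bool → Prop) :
    (ask κ S decision).verifiedLanguage A V ψ =
      {x | (∀ i ∈ S, x ∈ V i) ∧ ψ (decision fun i => decide (i ∈ S ∧ x ∈ A i))} := by
  ext x
  rw [mem_verifiedLanguage_iff_yields (n := 1) fun _ => ⟨_, rfl⟩, yields_succ,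
    verified_iff_of_query rfl]
  exact and_congr_right fun _ => (exists_congr fun _ => yields_of_halt rfl).trans (exists_const κ)

theorem verifiedLanguage_popAsk (A V : Bool → Lang) :
    popAsk.verifiedLanguage A V (· = true) = join fun b => V b ∩ A b := by
  ext x
  rw [mem_verifiedLanguage_iff_yields (popAsk_halts A · x), yields_succ,
    and_iff_right (verified_of_not_query (by rintro _ _ ⟨⟩)), Unique.exists_iff]
  rcases x with _ | ⟨b, w⟩
  · exact (yields_of_halt (b := false) rfl).trans (by simp [nil_notMem_join])
  · rw [yields_succ, Unique.exists_iff, yields_of_halt rfl, verified_iff_of_query rfl]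
    simp only [Finset.mem_singleton, forall_eq, true_and, decide_eq_true_eq, cons_mem_join,
      Set.mem_inter_iff]
    rfl

theorem verifiedLanguage_guessAsk (A V : Bool → Lang) :
    guessAsk.verifiedLanguage A V (· = true) = ⋃ b, V b ∩ A b := by
  ext x
  rw [mem_verifiedLanguage_iff_yields (n := 2) fun _ => ⟨_, rfl⟩, yields_succ,
    and_iff_right (verified_of_not_query (by rintro _ _ ⟨⟩)), Set.mem_iUnion]
  refine exists_congr fun b => ?_
  rw [yields_succ, exists_congr fun _ => yields_of_halt rfl, verified_iff_of_query rfl]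
  simp only [Finset.mem_singleton, forall_eq, true_and, decide_eq_true_eq, exists_const,
    Set.mem_inter_iff]
  rfl

theorem language_tagAsk (A : Unit → Lang) (b : Bool) :
    (tagAsk b).language A = {x | b :: x ∈ A ()} := by
  ext x
  rw [language_eq_verifiedLanguage, mem_verifiedLanguage_iff_yields (n := 2) fun _ => ⟨_, rfl⟩,
    yields_succ, Unique.exists_iff, yields_succ, Unique.exists_iff, yields_of_halt rfl]
  simp only [verified_univ, Finset.mem_singleton, true_and, decide_eq_true_eq,
    Set.mem_ofPred_eq]
  rfl

end OTM

open OTM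

/-! ### Closure properties of relativized classes -/

theorem exists_machine_of_deterministic {ι ι₁ ι' κ : Type} [LinearOrder ι] [Finite ι] [Finite ι']
    [Subsingleton ι₁] [Nonempty κ] {M : OTM ι κ} (hM : M.PolyTime) {N : ι → DTM ι₁}
    (hN : ∀ i, (N i).PolyTime) (oracle : ι → ι₁ → ι') :
    ∃ M' : OTM ι' κ, M'.PolyTime ∧
      ∀ O, M'.language O = M.language fun i => (N i).language fun j => O (oracle i j) := by
  let D : Substitution ι ι₁ ι' κ κ (fun _ => Unit) :=
    { outer := M
      inner := N
      oracle := oracle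
      outerChoice := id
      outerChoice_surjective := Function.surjective_id
      innerChoice := fun _ _ => ()
      innerChoice_surjective := fun _ _ => ⟨Classical.arbitrary κ, rfl⟩
      answer := fun _ => some
      outcome := id }
  refine ⟨D.machine, D.machine_polyTime hM hN fun i A => ⟨_, answersCorrectly_some (N i) A⟩,
    fun O => ?_⟩
  rw [D.machine_language hM hN fun i => answersCorrectly_some (N i) _,
    language_eq_verifiedLanguage, Substitution.acceptedLanguage]
  congr 1
  funext i
  exact answered_some (hN i) _

/-- The machine that accepts the words in the oracle `i`. -/
abbrev askOracle {ι : Type} (i : ι) : DTM ι :=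
  ask Unit {i} fun a => a i

theorem language_askOracle {ι : Type} (i : ι) (A : ι → Lang) :
    (askOracle i).language A = A i := by
  rw [language_eq_verifiedLanguage, verifiedLanguage_ask]
  ext x
  simp

section SingleOracle

variable {ι κ : Type} [LinearOrder ι] [Finite ι]

theorem language_mem_P {M : DTM ι} (hM : M.PolyTime) {A : ι → Lang} (hA : ∀ i, A i ∈ P) :
    M.language A ∈ P := by
  choose N hN hA using hA
  obtain ⟨M', hM', h⟩ := exists_machine_of_deterministic (ι' := Empty) hM hN fun _ j => j
  exact ⟨M', hM', by rw [h, funext hA]⟩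

theorem exists_machine_of_mem_pRel [Nonempty κ] {M : OTM ι κ} (hM : M.PolyTime) {A : ι → Lang}
    {E : Lang} (hA : ∀ i, A i ∈ PRel {E}) :
    ∃ M' : OTM Unit κ, M'.PolyTime ∧ M.language A = M'.language fun _ => E := by
  choose E' hE' N hN hA using hA
  obtain rfl : E' = fun _ => E := funext hE'
  obtain ⟨M', hM', h⟩ := exists_machine_of_deterministic hM hN fun _ j => j
  exact ⟨M', hM', by rw [h, funext hA]⟩

theorem mem_pRel_trans {A B E : Lang} (hAB : A ∈ PRel {B}) (hBE : B ∈ PRel {E}) :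
    A ∈ PRel {E} := by
  obtain ⟨_, rfl, M, hM, rfl⟩ := hAB
  obtain ⟨M', hM', h⟩ := exists_machine_of_mem_pRel hM fun _ => hBE
  exact ⟨E, rfl, M', hM', h⟩

theorem subset_pRel (C : CClass) : C ⊆ PRel C :=
  fun A hA => ⟨A, hA, askOracle (), polyTime_ask _ _, (language_askOracle () fun _ => A).symm⟩

theorem mem_pRel_join (A : Bool → Lang) (b : Bool) : A b ∈ PRel {join A} := by
  refine ⟨_, rfl, tagAsk b, polyTime_tagAsk b, ?_⟩
  simp [language_tagAsk, cons_mem_join]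

end SingleOracle

/-- The class contains some language and is closed under disjoint unions. It follows that finitely
many oracles from the class can be replaced by one. -/
def JoinClosed (C : CClass) : Prop :=
  C.Nonempty ∧ ∀ A : Bool → Lang, (∀ b, A b ∈ C) → join A ∈ C

theorem JoinClosed.exists_common_oracle {C : CClass} (hC : JoinClosed C) {ι : Type} [Finite ι]
    {A : ι → Lang} (hA : ∀ i, A i ∈ C) : ∃ E ∈ C, ∀ i, A i ∈ PRel {E} := by
  classical
  have := Fintype.ofFinite ι
  suffices h : ∀ T : Finset ι, ∃ E ∈ C, ∀ i ∈ T, A i ∈ PRel {E} by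
    simpa using h Finset.univ
  intro T
  induction T using Finset.induction_on with
  | empty => exact hC.1.imp fun _ hE => ⟨hE, by simp⟩
  | insert i T _ ih =>
    obtain ⟨E, hE, hT⟩ := ih
    let B : Bool → Lang := fun b => bif b then A i else E
    refine ⟨join B, hC.2 B (by simp [B, hE, hA]), fun j hj => ?_⟩
    rcases Finset.mem_insert.1 hj with rfl | hj
    · exact mem_pRel_join B true
    · exact mem_pRel_trans (hT j hj) (mem_pRel_join B false)

/-- Membership in `A` of the words of `V` can be verified with an oracle from `C`: some machine
gives only correct answers, and answers exactly the words in `V`. -/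
def Verifiable (C : CClass) (A V : Lang) : Prop :=
  ∃ O ∈ C, ∃ (κ : Type) (g : Bool → κ) (N : OTM Unit κ) (answer : Bool → Option Bool),
    g.Surjective ∧ N.PolyTime ∧ (∀ O', ∃ B, N.AnswersCorrectly answer O' B) ∧
      N.AnswersCorrectly answer (fun _ => O) A ∧ N.answered answer (fun _ => O) = V

theorem Verifiable.of_nPRel {C : CClass} {V : Lang} (a : Bool) (hV : V ∈ NPRel C) :
    Verifiable C {_w | a = true} V := by
  obtain ⟨O, hO, M, hM, rfl⟩ := hV
  let answer : Bool → Option Bool := fun b => bif b then some a else none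
  have hanswer (b a') : answer b = some a' ↔ b = true ∧ a' = a := by
    cases b <;> simp [answer, eq_comm]
  have hcorrect (O') : M.AnswersCorrectly answer O' {_w | a = true} := by
    intro x c t b a' _ ha'
    rw [((hanswer _ _).1 ha').2]
    rfl
  refine ⟨O, hO, Bool, id, M, answer, Function.surjective_id, hM, fun O' => ⟨_, hcorrect O'⟩,
    hcorrect _, ?_⟩
  simp [language_eq_verifiedLanguage, answered, hanswer]

theorem Verifiable.of_pRel {C : CClass} {A : Lang} (hA : A ∈ PRel C) :
    Verifiable C A Set.univ := by
  obtain ⟨O, hO, M, hM, rfl⟩ := hA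
  exact ⟨O, hO, Unit, fun _ => (), M, some, fun _ => ⟨true, rfl⟩, hM,
    fun O' => ⟨_, answersCorrectly_some M O'⟩, answersCorrectly_some M _, answered_some hM _⟩

namespace JoinClosed

variable {ι κ : Type} [Finite ι] {C : CClass}

theorem language_mem_pRel [LinearOrder ι] (hC : JoinClosed C) {M : DTM ι} (hM : M.PolyTime)
    {A : ι → Lang} (hA : ∀ i, A i ∈ PRel C) : M.language A ∈ PRel C := by
  choose B hB N hN hA using hA
  obtain ⟨E, hE, hBE⟩ := hC.exists_common_oracle hB
  obtain ⟨M', hM', h⟩ := exists_machine_of_mem_pRel hM (A := A) fun i =>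
    mem_pRel_trans ⟨_, rfl, N i, hN i, hA i⟩ (hBE i)
  exact ⟨E, hE, M', hM', h⟩

theorem verifiedLanguage_mem_nPRel [LinearOrder ι] (hC : JoinClosed C) {M : OTM ι κ}
    (hM : M.PolyTime) {f : Bool → κ} (hf : f.Surjective) {A V : ι → Lang}
    (hAV : ∀ i, Verifiable C (A i) (V i)) (outcome : Bool → Bool) :
    M.verifiedLanguage A V (outcome · = true) ∈ NPRel C := by
  choose O hO κ₂ g N answer hg hN hcons hA hV using hAV
  let D : Substitution ι Unit ι κ Bool κ₂ :=
    { outer := M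
      inner := N
      oracle := fun i _ => i
      outerChoice := f
      outerChoice_surjective := hf
      innerChoice := g
      innerChoice_surjective := hg
      answer := answer
      outcome := outcome }
  obtain ⟨E, hE, hOE⟩ := hC.exists_common_oracle hO
  obtain ⟨M', hM', h⟩ := exists_machine_of_mem_pRel (D.machine_polyTime hM hN hcons) hOE
  refine ⟨E, hE, M', hM', ?_⟩
  rw [← h, D.machine_language hM hN hA, Substitution.acceptedLanguage, ← funext hV]

theorem nPRel (hC : JoinClosed C) : JoinClosed (NPRel C) := by
  refine ⟨⟨_, hC.1.choose, hC.1.choose_spec, ask Bool ∅ fun _ => true, polyTime_ask _ _, rfl⟩,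
    fun A hA => ?_⟩
  have h := hC.verifiedLanguage_mem_nPRel (f := fun _ => ()) polyTime_popAsk (fun _ => ⟨true, rfl⟩)
    (fun b => .of_nPRel true (hA b)) id
  simpa [verifiedLanguage_popAsk] using h

theorem pRel_subset_nPRel (hC : JoinClosed C) : PRel C ⊆ NPRel C := by
  intro A hA
  simpa [verifiedLanguage_ask] using hC.verifiedLanguage_mem_nPRel (f := fun _ => ())
    (polyTime_ask {()} fun a => a ()) (fun _ => ⟨true, rfl⟩) (fun _ => .of_pRel hA) id

theorem pRel_subset_co_nPRel (hC : JoinClosed C) : PRel C ⊆ co (NPRel C) := by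
  intro A hA
  simpa [verifiedLanguage_ask, co, Set.compl_def] using
    hC.verifiedLanguage_mem_nPRel (f := fun _ => ())
    (polyTime_ask {()} fun a => a ()) (fun _ => ⟨true, rfl⟩) (fun _ => .of_pRel hA) not

theorem empty_mem_pRel (hC : JoinClosed C) : ∅ ∈ PRel C := by
  refine ⟨hC.1.choose, hC.1.choose_spec, ask Unit ∅ fun _ => false, polyTime_ask _ _, ?_⟩
  simp [language_eq_verifiedLanguage, verifiedLanguage_ask]

theorem union_mem_nPRel (hC : JoinClosed C) {A B : Lang} (hA : A ∈ NPRel C) (hB : B ∈ NPRel C) :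
    A ∪ B ∈ NPRel C := by
  have h := hC.verifiedLanguage_mem_nPRel polyTime_guessAsk Function.surjective_id
    (V := fun b => bif b then A else B)
    (fun b => .of_nPRel true (by cases b <;> assumption)) id
  simpa [verifiedLanguage_guessAsk, Set.union_eq_iUnion, Bool.cond_eq_ite] using h

theorem univ_mem_pRel (hC : JoinClosed C) : Set.univ ∈ PRel C := by
  refine ⟨hC.1.choose, hC.1.choose_spec, ask Unit ∅ fun _ => true, polyTime_ask _ _, ?_⟩
  simp [language_eq_verifiedLanguage, verifiedLanguage_ask]

theorem symmDiff_mem_pRel (hC : JoinClosed C) {A B : Lang} (hA : A ∈ PRel C) (hB : B ∈ PRel C) :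
    symmDiff A B ∈ PRel C := by
  have h := hC.language_mem_pRel (polyTime_ask Finset.univ fun a => xor (a true) (a false))
    (A := fun b => bif b then A else B) (by simp [hA, hB])
  rw [language_eq_verifiedLanguage, verifiedLanguage_ask] at h
  convert h using 1
  ext x
  by_cases hxA : x ∈ A <;> by_cases hxB : x ∈ B <;> simp [Set.mem_symmDiff, hxA, hxB]

theorem inter_mem_nPRel (hC : JoinClosed C) {A B : Lang} (hA : A ∈ NPRel C) (hB : B ∈ NPRel C) :
    A ∩ B ∈ NPRel C := by
  have h := hC.verifiedLanguage_mem_nPRel (f := fun _ => ())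
    (polyTime_ask Finset.univ fun _ => true) (fun _ => ⟨true, rfl⟩)
    (V := fun b => bif b then A else B) (fun b => .of_nPRel true (by cases b <;> assumption)) id
  convert h using 1
  ext x
  simp [verifiedLanguage_ask, and_comm]

theorem iUnion_mem_nPRel (hC : JoinClosed C) {A : ι → Lang} (hA : ∀ i, A i ∈ NPRel C) :
    ⋃ i, A i ∈ NPRel C := by
  have := Fintype.ofFinite ι
  rw [← Set.iSup_eq_iUnion, ← Finset.sup_univ_eq_iSup]
  exact Finset.sup_mem _ (hC.pRel_subset_nPRel hC.empty_mem_pRel)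
    (fun _ hA _ hB => hC.union_mem_nPRel hA hB) _ _ fun i _ => hA i

end JoinClosed

/-! ### Machines that query an oracle at most once -/

namespace OTM

variable {ι κ : Type} {M : OTM ι κ} {A B : ι → Lang} {x : List Bool}

theorem run_congr {c : ℕ → κ} {t : ℕ}
    (h : ∀ u < t, M.Verified (fun i => {w | w ∈ A i ↔ w ∈ B i}) (M.run A c x u)) :
    M.run B c x t = M.run A c x t := by
  induction t with
  | zero => rfl
  | succ t ih =>
    rw [run, run, ih fun u hu => h u (by lia)]
    have ht := h t (by lia)
    generalize M.run A c x t = s at ht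
    rcases hq : M.instr s.state with ⟨k, b, q'⟩ | ⟨k, next⟩ | next | ⟨S, next⟩ | b <;>
      simp only [step, hq]
    congr 2
    funext i
    congr 1
    exact propext (and_congr_right fun hi => (ht S next hq i hi).symm)

/-- In every computation, at most one step queries the oracle `i`. -/
def QueriesOnce (M : OTM ι κ) (i : ι) : Prop :=
  ∀ (A : ι → Lang) (c : ℕ → κ) (x : List Bool) (t u : ℕ) (S S' : Finset ι)
    (next next' : (ι → Bool) → M.Q), M.instr (M.run A c x t).state = .query S next →
    M.instr (M.run A c x u).state = .query S' next' → i ∈ S → i ∈ S' → t = u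

theorem QueriesOnce.exists_answer {i : ι} (hi : M.QueriesOnce i) (A : ι → Lang) (c : ℕ → κ)
    (x : List Bool) :
    ∃ a : Bool, ∀ u S next, M.instr (M.run A c x u).state = .query S next → i ∈ S →
      ((M.run A c x u).stk (M.qry i) ∈ A i ↔ a = true) := by
  by_cases h : ∃ u S next, M.instr (M.run A c x u).state = .query S next ∧ i ∈ S ∧
    (M.run A c x u).stk (M.qry i) ∈ A i
  · obtain ⟨u, S, next, hq, hS, hw⟩ := h
    refine ⟨true, fun v S' next' hq' hS' => ?_⟩
    obtain rfl := hi A c x u v S S' next next' hq hq' hS hS'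
    simpa using hw
  · push Not at h
    exact ⟨false, fun u S next hq hS => by simpa using h u S next hq hS⟩

/-- If the answers of all oracles are guessed in advance, then it remains to verify them. -/
theorem verifiedLanguage_univ_eq_iUnion (hM : ∀ i, M.QueriesOnce i) (A : ι → Lang)
    (ψ : Bool → Prop) :
    M.verifiedLanguage A (fun _ => Set.univ) ψ = ⋃ a : ι → Bool,
      M.verifiedLanguage (fun i => {_w | a i = true}) (fun i => {w | a i = true ↔ w ∈ A i}) ψ := by
  ext x
  rw [Set.mem_iUnion]
  constructor
  · rintro ⟨c, t, b, hb, hψ, -⟩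
    choose a ha using fun i => (hM i).exists_answer A c x
    have hrun (u) : M.run (fun i => {_w | a i = true}) c x u = M.run A c x u :=
      run_congr fun v _ S next hq i hi => ha i v S next hq hi
    refine ⟨a, c, t, b, by rwa [hrun], hψ, fun u _ => ?_⟩
    rw [hrun]
    exact fun S next hq i hi => (ha i u S next hq hi).symm
  · rintro ⟨a, c, t, b, hb, hψ, ha⟩
    exact ⟨c, t, b, by rwa [run_congr ha], hψ, fun _ _ => verified_univ _⟩

variable {M : DTM ι}

theorem mem_language_congr_of_halt {c : ℕ → Unit} {t : ℕ} {b : Bool}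
    (hb : M.instr (M.run A c x t).state = .halt b) (h : M.run B c x t = M.run A c x t) :
    x ∈ M.language A ↔ x ∈ M.language B := by
  rw [← answersCorrectly_some M A x c t b b hb rfl,
    ← answersCorrectly_some M B x c t b b (by rw [h, hb]) rfl]

theorem compl_language_eq_verifiedLanguage (hM : M.PolyTime) (A : ι → Lang) :
    (M.language A)ᶜ = M.verifiedLanguage A (fun _ => Set.univ) (fun b => (!b) = true) := by
  obtain ⟨p, hp⟩ := hM
  ext x
  have key (c t b) (hb : M.instr (M.run A c x t).state = .halt b) :=
    answersCorrectly_some M A x c t b b hb rfl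
  rw [Set.mem_compl_iff]
  constructor
  · intro hx
    obtain ⟨b, hb⟩ := hp A (fun _ => ()) x
    refine ⟨_, _, b, hb, ?_, fun _ _ => verified_univ _⟩
    simpa [← key _ _ b hb] using hx
  · rintro ⟨c, t, b, hb, hψ, -⟩
    simpa [← key c t b hb] using hψ

variable [DecidableEq ι] {s : ι}

theorem mem_language_iff_of_mem_verifiedLanguage {ψ : Bool → Prop}
    (hx : x ∈ M.verifiedLanguage (Function.update A s Set.univ)
      (Function.update (fun _ => Set.univ) s (A s)) ψ) :
    x ∈ M.language A ↔ x ∈ M.language (Function.update A s Set.univ) := by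
  obtain ⟨c, t, b, hb, -, hV⟩ := hx
  refine (mem_language_congr_of_halt hb (run_congr fun u hu S next hq i hi => ?_)).symm
  have hw := hV u hu S next hq i hi
  rcases eq_or_ne i s with rfl | his
  · simpa using hw
  · simp [his]

theorem QueriesOnce.mem_language_iff_of_notMem_verifiedLanguage (hs : M.QueriesOnce s)
    (hM : M.PolyTime) (hx : x ∉ M.verifiedLanguage (Function.update A s Set.univ)
      (Function.update (fun _ => Set.univ) s (A s)) (fun _ => True)) :
    x ∈ M.language A ↔ x ∈ M.language (Function.update A s ∅) := by
  obtain ⟨p, hp⟩ := hM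
  let c : ℕ → Unit := fun _ => ()
  obtain ⟨b, hb⟩ := hp A c x
  obtain ⟨a, ha⟩ := hs.exists_answer A c x
  have hrun (B : Lang) (hB : ∀ w, a = true ↔ w ∈ B) (u : ℕ) :
      M.run (Function.update A s B) c x u = M.run A c x u := by
    refine run_congr fun v _ S next hq i hi => ?_
    rcases eq_or_ne i s with rfl | his
    · simpa [← hB] using ha v S next hq hi
    · simp [his]
  cases a with
  | false => exact mem_language_congr_of_halt hb (hrun ∅ (by simp) _)
  | true =>
    refine absurd ⟨c, _, b, by rwa [hrun Set.univ (by simp)], trivial, fun u _ => ?_⟩ hx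
    rw [hrun Set.univ (by simp)]
    intro S next hq i hi
    rcases eq_or_ne i s with rfl | his
    · simpa using ha u S next hq hi
    · simp [his]

end OTM

namespace JoinClosed

variable {ι : Type} [LinearOrder ι] [Finite ι] {C D : CClass} {M : DTM ι} {A : ι → Lang}

theorem verifiedLanguage_univ_mem_nPRel (hC : JoinClosed C) (hM : M.PolyTime)
    (hone : ∀ i, M.QueriesOnce i) (hA : ∀ i, A i ∈ NPRel C ∩ co (NPRel C))
    (outcome : Bool → Bool) :
    M.verifiedLanguage A (fun _ => Set.univ) (outcome · = true) ∈ NPRel C := by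
  rw [verifiedLanguage_univ_eq_iUnion hone]
  refine hC.iUnion_mem_nPRel fun a => hC.verifiedLanguage_mem_nPRel (f := fun _ => ()) hM
    (fun _ => ⟨true, rfl⟩) (fun i => .of_nPRel (a i) ?_) outcome
  cases a i with
  | false => simpa [co, Set.compl_def] using (hA i).2
  | true => simpa using (hA i).1

theorem language_mem_nPRel_inter_co (hC : JoinClosed C) (hM : M.PolyTime)
    (hone : ∀ i, M.QueriesOnce i) (hA : ∀ i, A i ∈ NPRel C ∩ co (NPRel C)) :
    M.language A ∈ NPRel C ∩ co (NPRel C) := by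
  constructor
  · rw [language_eq_verifiedLanguage]
    exact hC.verifiedLanguage_univ_mem_nPRel hM hone hA id
  · rw [co, Set.mem_ofPred_eq, compl_language_eq_verifiedLanguage hM]
    exact hC.verifiedLanguage_univ_mem_nPRel hM hone hA not

/-- The language changes only on inputs for which the answer `yes` to the query is correct. -/
theorem exists_language_eq_symmDiff (hC : JoinClosed C) (hD : JoinClosed D)
    (hCD : PRel C ⊆ PRel D) (hM : M.PolyTime) {s : ι} (hone : M.QueriesOnce s)
    (hs : A s ∈ NPRel D) (hA : ∀ i ≠ s, A i ∈ PRel C) :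
    ∃ B ∈ PRel C, ∃ B' ∈ NPRel D, M.language A = symmDiff B B' := by
  have hupdate {B : Lang} (hB : B ∈ PRel C) : M.language (Function.update A s B) ∈ PRel C := by
    refine hC.language_mem_pRel hM ?_
    rw [Function.forall_update_iff A fun _ L => L ∈ PRel C]
    exact ⟨hB, hA⟩
  have hL₀ := hupdate hC.empty_mem_pRel
  have hL₁ := hupdate hC.univ_mem_pRel
  let W := M.verifiedLanguage (Function.update A s Set.univ)
    (Function.update (fun _ => Set.univ) s (A s)) fun _ => True
  have hW : W ∈ NPRel D := by
    have hV (i : ι) : Verifiable D (Function.update A s Set.univ i)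
        (Function.update (fun _ => Set.univ) s (A s) i) := by
      rcases eq_or_ne i s with rfl | hi
      · simpa using Verifiable.of_nPRel true hs
      · simpa [hi] using Verifiable.of_pRel (hCD (hA i hi))
    simpa using
      hD.verifiedLanguage_mem_nPRel (f := fun _ => ()) hM (fun _ => ⟨true, rfl⟩) hV fun _ => true
  refine ⟨_, hL₀, _, hD.inter_mem_nPRel hW
    (hD.pRel_subset_nPRel (hCD (hC.symmDiff_mem_pRel hL₀ hL₁))), ?_⟩
  ext x
  rw [Set.mem_symmDiff, Set.mem_inter_iff, Set.mem_symmDiff]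
  by_cases hx : x ∈ W
  · rw [mem_language_iff_of_mem_verifiedLanguage hx]
    tauto
  · rw [hone.mem_language_iff_of_notMem_verifiedLanguage hM hx]
    tauto

end JoinClosed

/-! ### The polynomial hierarchy -/

theorem joinClosed_P : JoinClosed P := by
  refine ⟨⟨_, ask Unit ∅ fun _ => true, polyTime_ask _ _, rfl⟩, fun A hA => ?_⟩
  have h := language_mem_P polyTime_popAsk hA
  rwa [language_eq_verifiedLanguage, verifiedLanguage_popAsk,
    funext fun b => Set.univ_inter (A b)] at h

theorem joinClosed_sigmaP (m : ℕ) : JoinClosed (SigmaP m) := by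
  induction m with
  | zero => exact joinClosed_P
  | succ m ih => exact ih.nPRel

theorem sigmaP_subset_deltaP_succ (m : ℕ) : SigmaP m ⊆ DeltaP (m + 1) :=
  subset_pRel _

theorem deltaP_subset_sigmaP_inter_piP (m : ℕ) : DeltaP m ⊆ SigmaP m ∩ PiP m := by
  cases m with
  | zero => exact fun A hA => ⟨hA, hA⟩
  | succ m =>
    have h := joinClosed_sigmaP m
    exact Set.subset_inter h.pRel_subset_nPRel h.pRel_subset_co_nPRel

theorem deltaP_mono : Monotone DeltaP :=
  monotone_nat_of_le_succ fun m => ((deltaP_subset_sigmaP_inter_piP m).trans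
    Set.inter_subset_left).trans (sigmaP_subset_deltaP_succ m)

theorem sigmaP_subset_deltaP {m n : ℕ} (h : m < n) : SigmaP m ⊆ DeltaP n :=
  (sigmaP_subset_deltaP_succ m).trans (deltaP_mono h)

theorem sigmaP_inter_piP_mono : Monotone fun m => SigmaP m ∩ PiP m :=
  monotone_nat_of_le_succ fun m => (Set.inter_subset_left.trans
    (sigmaP_subset_deltaP_succ m)).trans (deltaP_subset_sigmaP_inter_piP (m + 1))

/-! ### Restricted machines -/

/-- `ins.Preserves e J l`: if the log `l` is extended by `e S` when `ins` is a query step about `S`,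
then the new log satisfies `J` together with any state to which `ins` may lead. -/
def Instr.Preserves {ι ι' κ K Q : Type} (e : Finset ι → List (Finset ι'))
    (J : Q → List (Finset ι') → Prop) (l : List (Finset ι')) : Instr ι κ K Q → Prop
  | .push _ _ q => J q l
  | .pop _ next => ∀ o, J (next o) l
  | .branch next => ∀ c, J (next c) l
  | .query S next => ∀ a, J (next a) (l ++ e S)
  | .halt _ => True

/-- No two query steps of a computation with the restriction `R` query the oracle `i`. -/
def AllowsOnce {ι : Type} (R : List (Finset ι) → Prop) (i : ι) : Prop :=
  ∀ l, R l → ∀ S S', [S, S'].Sublist l → i ∈ S → i ∉ S'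

namespace OTM

variable {ι ι' κ : Type} {M : OTM ι κ}

theorem log_step_of_query {A : ι → Lang} {c : κ} {s : M.Cfg} {S : Finset ι}
    {next : (ι → Bool) → M.Q} (hs : M.instr s.state = .query S next) :
    (M.step A c s).log = s.log ++ [S] := by
  simp only [step, hs]

theorem log_run_prefix (A : ι → Lang) (c : ℕ → κ) (x : List Bool) {t u : ℕ} (htu : t ≤ u) :
    (M.run A c x t).log <+: (M.run A c x u).log := by
  induction u, htu using Nat.le_induction with
  | base => exact List.prefix_rfl
  | succ u _ ih =>
    refine ih.trans ?_
    rw [run]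
    generalize M.run A c x u = s
    rcases hq : M.instr s.state with ⟨k, b, q'⟩ | ⟨k, next⟩ | next | ⟨S, next⟩ | b <;>
      simp only [step, hq, List.prefix_rfl, List.prefix_append]

theorem Restricted.queriesOnce {R : List (Finset ι) → Prop} (hM : M.Restricted R) {i : ι}
    (hR : AllowsOnce R i) : M.QueriesOnce i := by
  have not_before {A c x} {t u : ℕ} {S S' next next'}
      (ht : M.instr (M.run A c x t).state = .query S next)
      (hu : M.instr (M.run A c x u).state = .query S' next') (hS : i ∈ S) (hS' : i ∈ S') :
      ¬t < u := by
    intro htu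
    refine hR _ (hM A c x (u + 1)) S S' ?_ hS hS'
    have hprefix := log_run_prefix (M := M) A c x (Nat.succ_le_of_lt htu)
    rw [Nat.succ_eq_add_one, run, log_step_of_query ht] at hprefix
    rw [run, log_step_of_query hu]
    exact ((List.sublist_append_right _ [S]).trans hprefix.sublist).append (.refl [S'])
  intro A c x t u S S' next next' ht hu hS hS'
  exact le_antisymm (not_lt.1 (not_before hu ht hS' hS)) (not_lt.1 (not_before ht hu hS hS'))

/-- The condition `J` on a state and a log is an invariant of the machine `M` if a query step about
`S` extends the log by `e S`. -/
structure LogInvariant (M : OTM ι κ) (e : Finset ι → List (Finset ι'))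
    (J : M.Q → List (Finset ι') → Prop) : Prop where
  start : J M.start []
  step {q : M.Q} {l : List (Finset ι')} : J q l → (M.instr q).Preserves e J l

theorem LogInvariant.run {J : M.Q → List (Finset ι) → Prop} (h : M.LogInvariant (fun S => [S]) J)
    (A : ι → Lang) (c : ℕ → κ) (x : List Bool) (t : ℕ) :
    J (M.run A c x t).state (M.run A c x t).log := by
  induction t with
  | zero => exact h.start
  | succ t ih =>
    rw [OTM.run]
    generalize M.run A c x t = s at ih
    have hstep := h.step ih
    rcases hq : M.instr s.state with ⟨k, b, q'⟩ | ⟨k, next⟩ | next | ⟨S, next⟩ | b <;>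
      simp only [hq, Instr.Preserves] at hstep <;> simp only [OTM.step, hq]
    all_goals first | exact hstep | exact hstep _ | exact ih

theorem logInvariant_ask (S : Finset ι) (decision : (ι → Bool) → Bool)
    (e : Finset ι → List (Finset ι')) :
    (ask κ S decision).LogInvariant e fun q l => l = q.elim [] fun _ => e S where
  start := rfl
  step {q l} hl := by
    subst hl
    cases q
    · exact fun _ => rfl
    · trivial

theorem restricted_ask {S : Finset ι} {decision : (ι → Bool) → Bool}
    {R : List (Finset ι) → Prop} (h0 : R []) (h1 : R [S]) : (ask κ S decision).Restricted R := by
  intro A c x t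
  rw [(logInvariant_ask (κ := κ) S decision fun S => [S]).run A c x t]
  cases ((ask κ S decision).run A c x t).state
  · exact h0
  · exact h1

end OTM

/-! ### Combining the outcomes of several machines -/

/-- The contribution to the log of a query step about `S` of a machine whose queries are passed on
to the oracle `i`. -/
def queriesFor {ι : Type} (i : ι) (S : Finset Unit) : List (Finset ι) :=
  if S.Nonempty then [{i}] else []

theorem queriesFor_singleton {ι : Type} (i : ι) : queriesFor i {()} = [{i}] :=
  if_pos (Finset.singleton_nonempty _)

/-- The machine that runs the machines `N i` on its input, in increasing order of `i`, and applies
`decision` to their outcomes. The queries of `N i` are passed on to the oracle `i`. -/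
@[reducible] noncomputable def combination {ι : Type} [Fintype ι] (N : ι → DTM Unit)
    (decision : (ι → Bool) → Bool) : Substitution ι Unit ι Unit Unit fun _ => Unit where
  outer := ask Unit Finset.univ decision
  inner := N
  oracle i _ := i
  outerChoice := id
  outerChoice_surjective := Function.surjective_id
  innerChoice _ := id
  innerChoice_surjective _ := Function.surjective_id
  answer _ := some
  outcome := id

section Combination

variable {ι : Type} [LinearOrder ι] [Fintype ι] {N : ι → DTM Unit} {decision : (ι → Bool) → Bool}

theorem polyTime_combination (hN : ∀ i, (N i).PolyTime) :
    (combination N decision).machine.PolyTime :=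
  (combination N decision).machine_polyTime (polyTime_ask _ _) hN
    fun i A => ⟨_, answersCorrectly_some (N i) A⟩

open Classical in
theorem language_combination (hN : ∀ i, (N i).PolyTime) (O : ι → Lang) :
    (combination N decision).machine.language O =
      {x | decision fun i => decide (x ∈ (N i).language fun _ => O i)} := by
  rw [(combination N decision).machine_language (polyTime_ask _ _) hN
    fun i => answersCorrectly_some (N i) _, Substitution.acceptedLanguage, verifiedLanguage_ask]
  simp [answered_some (hN _)]

variable (N decision) in
/-- The invariant of `combination N decision` that results from invariants `I i` of the machines
`N i` and a condition `K R` on the logs at the times when the machines `N i` with `i ∈ R` have not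
been started and the others have been run. -/
def CombinationInvariant (I : ∀ i, (N i).Q → List (Finset ι) → Prop)
    (K : Finset ι → List (Finset ι) → Prop) :
    (combination N decision).State → List (Finset ι) → Prop
  | .main (.inl q), l | .clear _ (.inl q), l => K (q.elim Finset.univ fun _ => ∅) l
  | .main (.inr x), l | .clear _ (.inr x), l => x.1 = none ∧ K x.2.1 l
  | .unload x i, l | .unloadPush x i _, l | .load x i, l | .loadPush x i _, l
  | .loadPush' x i _, l => x.1 = none ∧ (∃ h, x.2.1.min' h = i) ∧ K x.2.1 l
  | .work x i q, l => x.1 = none ∧ (∃ h, x.2.1.min' h = i) ∧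
      ∃ l₀ l₁, l₀ ++ l₁ = l ∧ K x.2.1 l₀ ∧ I i q l₁

variable {I : ∀ i, (N i).Q → List (Finset ι) → Prop} {K : Finset ι → List (Finset ι) → Prop}

theorem preserves_work (hI : ∀ i, (N i).LogInvariant (queriesFor i) (I i))
    (hrun : ∀ R (h : R.Nonempty) l q l', K R l → I (R.min' h) q l' →
      K (R.erase (R.min' h)) (l ++ l'))
    {x : (combination N decision).Task} {i : ι} {q : (N i).Q} {l : List (Finset ι)}
    (hl : CombinationInvariant N decision I K (.work x i q) l) :
    ((combination N decision).program (.work x i q)).Preserves (fun S => [S])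
      (CombinationInvariant N decision I K) l := by
  obtain ⟨hx, hi, l₀, l₁, rfl, hl₀, hl₁⟩ := hl
  have hstep := (hI i).step hl₁
  dsimp only [Substitution.program]
  rcases hq : (N i).instr q with ⟨k, b, q'⟩ | ⟨k, next⟩ | next | ⟨S, next⟩ | b <;>
    simp only [hq, Instr.Preserves] at hstep ⊢
  · exact ⟨hx, hi, l₀, l₁, rfl, hl₀, hstep⟩
  · exact fun o => ⟨hx, hi, l₀, l₁, rfl, hl₀, hstep o⟩
  · exact fun c => ⟨hx, hi, l₀, l₁, rfl, hl₀, hstep c⟩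
  · rcases S.eq_empty_or_nonempty with rfl | hS
    · rw [if_neg Finset.not_nonempty_empty]
      simp only [queriesFor, Finset.not_nonempty_empty, if_false, List.append_nil] at hstep
      exact fun _ => ⟨hx, hi, l₀, l₁, rfl, hl₀, hstep _⟩
    · rw [if_pos hS, @Finset.image_const _ _ (Classical.propDecidable <| · = ·) _ hS]
      simp only [queriesFor, if_pos hS] at hstep
      exact fun a => ⟨hx, hi, l₀, _, (List.append_assoc _ _ _).symm, hl₀, hstep _⟩
  · obtain ⟨hR, rfl⟩ := hi
    exact fun _ => ⟨hx, hrun _ hR _ _ _ hl₀ hl₁⟩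

theorem logInvariant_combination (hI : ∀ i, (N i).LogInvariant (queriesFor i) (I i))
    (hstart : K Finset.univ [])
    (hrun : ∀ R (h : R.Nonempty) l q l', K R l → I (R.min' h) q l' →
      K (R.erase (R.min' h)) (l ++ l')) :
    (combination N decision).machine.LogInvariant (fun S => [S])
      (CombinationInvariant N decision I K) := by
  refine ⟨hstart, fun {q l} hl => ?_⟩
  rcases q with ((_ | b) | ⟨q, R, a⟩) | ⟨T, r⟩ | ⟨x, i⟩ | ⟨x, i, b⟩ | ⟨x, i⟩ | ⟨x, i, b⟩ |
    ⟨x, i, b⟩ | ⟨x, i, q⟩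
  · exact fun _ => ⟨rfl, hl⟩
  · trivial
  · obtain ⟨rfl : q = none, hl⟩ := hl
    dsimp only [Substitution.program]
    rcases R.eq_empty_or_nonempty with rfl | hR
    · rw [dif_neg Finset.not_nonempty_empty]
      exact fun _ => hl
    · rw [dif_pos hR]
      exact fun _ => ⟨rfl, ⟨hR, rfl⟩, hl⟩
  · dsimp only [Substitution.program]
    split_ifs
    · rcases r with r | r <;> rintro (_ | _) <;> exact hl
    · rcases r with r | r <;> exact fun _ => hl
  · rintro (_ | _) <;> exact hl
  · exact hl
  · rintro (_ | _)
    · exact ⟨hl.1, hl.2.1, l, [], l.append_nil, hl.2.2, (hI i).start⟩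
    · exact hl
  · exact hl
  · exact hl
  · exact preserves_work hI hrun hl

theorem restricted_combination (hI : ∀ i, (N i).LogInvariant (queriesFor i) (I i))
    (hstart : K Finset.univ [])
    (hrun : ∀ R (h : R.Nonempty) l q l', K R l → I (R.min' h) q l' →
      K (R.erase (R.min' h)) (l ++ l'))
    {𝓡 : List (Finset ι) → Prop} (hK : ∀ R l, K R l → 𝓡 l) :
    (combination N decision).machine.Restricted 𝓡 := by
  have key (q : (combination N decision).State) (l) (hl : CombinationInvariant N decision I K q l) :
      𝓡 l := by
    rcases q with (q | x) | ⟨T, q | x⟩ | ⟨x, i⟩ | ⟨x, i, b⟩ | ⟨x, i⟩ | ⟨x, i, b⟩ |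
      ⟨x, i, b⟩ | ⟨x, i, q⟩
    · exact hK _ _ hl
    · exact hK _ _ hl.2
    · exact hK _ _ hl
    · exact hK _ _ hl.2
    · exact hK _ _ hl.2.2
    · exact hK _ _ hl.2.2
    · exact hK _ _ hl.2.2
    · exact hK _ _ hl.2.2
    · exact hK _ _ hl.2.2
    · obtain ⟨-, ⟨hR, rfl⟩, l₀, l₁, rfl, hl₀, hl₁⟩ := hl
      exact hK _ _ (hrun _ hR _ _ _ hl₀ hl₁)
  exact fun A c x t => key _ _ ((logInvariant_combination hI hstart hrun).run A c x t)

end Combination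

/-! ### Exclusive disjunctions -/

section Fin

variable {M₀ M₁ : DTM Unit} {decision : (Fin 2 → Bool) → Bool}

theorem restricted_combination_fin_two {I₀ : M₀.Q → List (Finset (Fin 2)) → Prop}
    {I₁ : M₁.Q → List (Finset (Fin 2)) → Prop} (h₀ : M₀.LogInvariant (queriesFor 0) I₀)
    (h₁ : M₁.LogInvariant (queriesFor 1) I₁) {R : List (Finset (Fin 2)) → Prop}
    (hR : ∀ q₀ l₀ q₁ l₁, I₀ q₀ l₀ → I₁ q₁ l₁ → R (l₀ ++ l₁)) :
    (combination ![M₀, M₁] decision).machine.Restricted R := by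
  let I : ∀ i, (![M₀, M₁] i).Q → List (Finset (Fin 2)) → Prop := Fin.cases I₀ (Fin.cases I₁ nofun)
  let K (T : Finset (Fin 2)) (l : List (Finset (Fin 2))) : Prop :=
    ∃ q₀ l₀ q₁ l₁, l₀ ++ l₁ = l ∧ I₀ q₀ l₀ ∧ I₁ q₁ l₁ ∧ (0 ∈ T → l₀ = [] ∧ l₁ = []) ∧
      (1 ∈ T → l₁ = [])
  refine restricted_combination (I := I) (K := K) (Fin.forall_fin_two.2 ⟨h₀, h₁⟩) ?_ ?_ ?_
  · exact ⟨_, [], _, [], rfl, h₀.start, h₁.start, fun _ => ⟨rfl, rfl⟩, fun _ => rfl⟩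
  · rintro T hT _ q l' ⟨q₀, l₀, q₁, l₁, rfl, hl₀, hl₁, hT₀, hT₁⟩ hl'
    have hmem := T.min'_mem hT
    have hle : ∀ j ∈ T, T.min' hT ≤ j := T.min'_le
    generalize T.min' hT = i at q hl' hmem hle
    have hcases : ∀ j : Fin 2, j = 0 ∨ j = 1 := by decide
    obtain rfl | rfl := hcases i
    · obtain ⟨rfl, rfl⟩ := hT₀ hmem
      exact ⟨q, l', _, [], List.append_nil _, hl', h₁.start, by simp, fun _ => rfl⟩
    · obtain rfl := hT₁ hmem
      have h0 : 0 ∉ T := fun h => by simpa using hle 0 h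
      exact ⟨q₀, l₀, q, l', by simp, hl₀, hl', by simp [h0], by simp⟩
  · rintro T _ ⟨q₀, l₀, q₁, l₁, rfl, hl₀, hl₁, -, -⟩
    exact hR _ _ _ _ hl₀ hl₁

theorem language_combination_xor (h₀ : M₀.PolyTime) (h₁ : M₁.PolyTime) (O : Fin 2 → Lang) :
    (combination ![M₀, M₁] fun a => a 0 ^^ a 1).machine.language O =
      symmDiff (M₀.language fun _ => O 0) (M₁.language fun _ => O 1) := by
  rw [language_combination (Fin.forall_fin_two.2 ⟨h₀, h₁⟩)]
  ext x
  simp only [Matrix.cons_val_zero, Matrix.cons_val_one, Matrix.cons_val_fin_one, bne_iff_ne, ne_eq,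
    Set.mem_ofPred_eq, Set.mem_symmDiff]
  grind

end Fin

theorem sublist_of_ask {q : Option Bool} {i : Fin 2} :
    (q.elim [] fun _ => queriesFor i {()}).Sublist [{i}] := by
  cases q <;> simp [queriesFor_singleton]

theorem logInvariant_queriesFor (M : DTM Unit) {ι : Type} (i : ι) :
    M.LogInvariant (queriesFor i) fun _ l => ∀ S ∈ l, S = {i} where
  start := List.forall_mem_nil _
  step {q l} hl := by
    rcases M.instr q with _ | _ | _ | ⟨S, _⟩ | _
    · exact hl
    · exact fun _ => hl
    · exact fun _ => hl
    · refine fun _ => List.forall_mem_append.2 ⟨hl, fun S' hS' => ?_⟩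
      rw [queriesFor] at hS'
      split_ifs at hS'
      · exact List.mem_singleton.1 hS'
      · cases hS'
    · trivial

section SymmDiff

variable {C D : CClass} {A B : Lang}

theorem symmDiff_mem_pParallel (hA : A ∈ C) (hB : B ∈ D) : symmDiff A B ∈ PParallel C D := by
  refine ⟨A, hA, B, hB, ask Unit Finset.univ fun a => a 0 ^^ a 1, polyTime_ask _ _,
    restricted_ask (by simp) (by simp), ?_⟩
  rw [language_eq_verifiedLanguage, verifiedLanguage_ask]
  ext x
  simp only [Set.mem_symmDiff, Finset.mem_univ, Set.mem_univ, imp_self, implies_true, true_and,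
    Matrix.cons_val_zero, Matrix.cons_val_one, Matrix.cons_val_fin_one, bne_iff_ne, ne_eq,
    Set.mem_ofPred_eq]
  grind

theorem symmDiff_mem_pOrdered (hA : A ∈ C) (hB : B ∈ D) : symmDiff A B ∈ POrdered C D := by
  have hask : (askOracle ()).PolyTime := polyTime_ask _ _
  refine ⟨A, hA, B, hB, (combination ![askOracle (), askOracle ()] fun a => a 0 ^^ a 1).machine,
    polyTime_combination (Fin.forall_fin_two.2 ⟨hask, hask⟩),
    restricted_combination_fin_two (logInvariant_ask _ _ _) (logInvariant_ask _ _ _) ?_, ?_⟩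
  · rintro q₀ _ q₁ _ rfl rfl
    exact sublist_of_ask.append sublist_of_ask
  · simp [language_combination_xor hask hask, language_askOracle]

theorem symmDiff_mem_pOnePoly (hA : A ∈ C) (hB : B ∈ PRel D) : symmDiff A B ∈ POnePoly C D := by
  obtain ⟨E, hE, M, hM, rfl⟩ := hB
  have hask : (askOracle ()).PolyTime := polyTime_ask _ _
  refine ⟨A, hA, E, hE, (combination ![askOracle (), M] fun a => a 0 ^^ a 1).machine,
    polyTime_combination (Fin.forall_fin_two.2 ⟨hask, hM⟩),
    restricted_combination_fin_two (logInvariant_ask _ _ _) (logInvariant_queriesFor M 1) ?_, ?_⟩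
  · rintro q₀ _ - l₁ rfl h₁
    have h₀ : (q₀.elim [] fun _ => queriesFor 0 {()}).Sublist [({0} : Finset (Fin 2))] :=
      sublist_of_ask
    have hcount : l₁.count {0} = 0 := List.count_eq_zero.2 fun h => by simpa using h₁ _ h
    refine ⟨List.forall_mem_append.2 ⟨fun S hS => .inl ?_, fun S hS => .inr (h₁ S hS)⟩, ?_⟩
    · exact List.mem_singleton.1 (h₀.subset hS)
    · rw [List.count_append, hcount]
      exact h₀.count_le _
  · simp [language_combination_xor hask hM, language_askOracle]

end SymmDiff

/-! ### The classes with two oracles -/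

section TwoOracles

variable {R : List (Finset (Fin 2)) → Prop} {C D : CClass}

theorem subset_pTwo_left (h0 : R []) (h1 : R [{0}]) (hD : D.Nonempty) : C ⊆ PTwo R C D := by
  intro L hL
  obtain ⟨B, hB⟩ := hD
  refine ⟨L, hL, B, hB, askOracle 0, polyTime_ask _ _, restricted_ask h0 h1, ?_⟩
  rw [language_askOracle]
  rfl

theorem subset_pTwo_right (h0 : R []) (h1 : R [{1}]) (hC : C.Nonempty) : D ⊆ PTwo R C D := by
  intro L hL
  obtain ⟨A, hA⟩ := hC
  refine ⟨A, hA, L, hL, askOracle 1, polyTime_ask _ _, restricted_ask h0 h1, ?_⟩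
  rw [language_askOracle]
  rfl

theorem allowsOnce_of_length_le_one (i : Fin 2) : AllowsOnce (fun l => l.length ≤ 1) i :=
  fun _ hl _ _ h => absurd (h.length_le.trans hl) (by simp)

theorem allowsOnce_of_sublist {a b : Fin 2} (hab : a ≠ b) (i : Fin 2) :
    AllowsOnce (fun l => l.Sublist [{a}, {b}]) i := by
  intro l hl S S' h hi hi'
  have heq : [S, S'] = [{a}, {b}] := (h.trans hl).eq_of_length rfl
  obtain ⟨rfl, rfl⟩ : S = {a} ∧ S' = {b} := by simpa using heq
  exact hab ((Finset.mem_singleton.1 hi).symm.trans (Finset.mem_singleton.1 hi'))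

theorem AllowsOnce.or {ι : Type} {R R' : List (Finset ι) → Prop} {i : ι} (h : AllowsOnce R i)
    (h' : AllowsOnce R' i) : AllowsOnce (fun l => R l ∨ R' l) i :=
  fun l hl => hl.elim (h l) (h' l)

theorem allowsOnce_of_count_le_one :
    AllowsOnce (fun l : List (Finset (Fin 2)) =>
      (∀ S ∈ l, S = {0} ∨ S = {1}) ∧ l.count {0} ≤ 1) 0 := by
  rintro l ⟨hsingle, hcount⟩ S S' h hS hS'
  have eq_zero {T : Finset (Fin 2)} (hT : T ∈ [S, S']) (h0 : 0 ∈ T) : T = {0} :=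
    (hsingle T (h.subset hT)).resolve_right (by rintro rfl; simp at h0)
  obtain rfl := eq_zero (by simp) hS
  obtain rfl := eq_zero (by simp) hS'
  exact absurd ((h.count_le {0}).trans hcount) (by simp)

end TwoOracles

/-- All classes with at most one query to `C` and at most one query to `D` that occur in the
corollary are equal to `Z`. -/
def CollapsesTo (C D Z : CClass) : Prop :=
  PParallel C D = POrdered C D ∧ POrdered C D = POrdered D C ∧
    POrdered D C = PAnyOrder D C ∧ PAnyOrder D C = Z

section CollapsesTo

variable {C D Z : CClass}

theorem pOrdered_subset_pAnyOrder : POrdered C D ⊆ PAnyOrder C D := by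
  rintro L ⟨A, hA, B, hB, M, hM, hR, h⟩
  exact ⟨A, hA, B, hB, M, hM, fun O c x t => .inl (hR O c x t), h⟩

theorem collapsesTo_of_subset
    (hle : ∀ R, (∀ i, AllowsOnce R i) → PTwo R C D ⊆ Z ∧ PTwo R D C ⊆ Z)
    (hparallel : Z ⊆ PParallel C D) (hordered : Z ⊆ POrdered C D) (hordered' : Z ⊆ POrdered D C) :
    CollapsesTo C D Z := by
  have hR (i : Fin 2) : AllowsOnce (fun l => l.Sublist [{0}, {1}]) i :=
    allowsOnce_of_sublist Fin.zero_ne_one i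
  have hR' (i : Fin 2) : AllowsOnce (fun l => l.Sublist [{1}, {0}]) i :=
    allowsOnce_of_sublist Fin.zero_ne_one.symm i
  have eq_parallel : PParallel C D = Z := (hle _ allowsOnce_of_length_le_one).1.antisymm hparallel
  have eq_ordered : POrdered C D = Z := (hle _ hR).1.antisymm hordered
  have eq_ordered' : POrdered D C = Z := (hle _ hR).2.antisymm hordered'
  have eq_anyOrder : PAnyOrder D C = Z :=
    (hle _ fun i => (hR i).or (hR' i)).2.antisymm (hordered'.trans pOrdered_subset_pAnyOrder)
  rw [CollapsesTo, eq_parallel, eq_ordered, eq_ordered', eq_anyOrder]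
  exact ⟨rfl, rfl, rfl, rfl⟩

theorem collapsesTo_left
    (hle : ∀ R, (∀ i, AllowsOnce R i) → PTwo R C D ⊆ C ∧ PTwo R D C ⊆ C) (hD : D.Nonempty) :
    CollapsesTo C D C :=
  collapsesTo_of_subset hle (subset_pTwo_left (by simp) (by simp) hD)
    (subset_pTwo_left (by simp) (by simp) hD) (subset_pTwo_right (by simp) (by simp) hD)

theorem collapsesTo_right
    (hle : ∀ R, (∀ i, AllowsOnce R i) → PTwo R C D ⊆ D ∧ PTwo R D C ⊆ D) (hC : C.Nonempty) :
    CollapsesTo C D D :=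
  collapsesTo_of_subset hle (subset_pTwo_right (by simp) (by simp) hC)
    (subset_pTwo_right (by simp) (by simp) hC) (subset_pTwo_left (by simp) (by simp) hC)

end CollapsesTo

/-! ### One query to an `NP^D` set and one to a `P^C` set -/

namespace JoinClosed

variable {R : List (Finset (Fin 2)) → Prop} {C D : CClass}

theorem pTwo_nPRel_pRel_subset (hC : JoinClosed C) (hD : JoinClosed D) (hCD : PRel C ⊆ PRel D)
    (hR : AllowsOnce R 0) :
    PTwo R (NPRel D) (PRel C) ⊆ Set.image2 symmDiff (PRel C) (NPRel D) := by
  rintro _ ⟨A, hA, B, hB, M, hM, hMR, rfl⟩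
  obtain ⟨E, hE, F, hF, h⟩ := hC.exists_language_eq_symmDiff hD hCD hM (hMR.queriesOnce hR)
    (A := ![A, B]) hA fun i hi => by rwa [Fin.eq_one_of_ne_zero i hi]
  exact ⟨E, hE, F, hF, h.symm⟩

theorem pTwo_pRel_nPRel_subset (hC : JoinClosed C) (hD : JoinClosed D) (hCD : PRel C ⊆ PRel D)
    (hR : AllowsOnce R 1) :
    PTwo R (PRel C) (NPRel D) ⊆ Set.image2 symmDiff (PRel C) (NPRel D) := by
  rintro _ ⟨A, hA, B, hB, M, hM, hMR, rfl⟩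
  obtain ⟨E, hE, F, hF, h⟩ := hC.exists_language_eq_symmDiff hD hCD hM (hMR.queriesOnce hR)
    (A := ![A, B]) hB fun i hi => by rwa [(by lia : i = 0)]
  exact ⟨E, hE, F, hF, h.symm⟩

theorem pOnePoly_nPRel_eq_image2_symmDiff (hC : JoinClosed C) (hD : JoinClosed D)
    (hCD : PRel C ⊆ PRel D) :
    POnePoly (NPRel D) C = Set.image2 symmDiff (PRel C) (NPRel D) := by
  refine Set.Subset.antisymm ?_ ?_
  · rintro _ ⟨A, hA, B, hB, h⟩
    exact hC.pTwo_nPRel_pRel_subset hD hCD allowsOnce_of_count_le_one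
      ⟨A, hA, B, subset_pRel C hB, h⟩
  · rintro _ ⟨A, hA, B, hB, rfl⟩
    rw [symmDiff_comm]
    exact symmDiff_mem_pOnePoly hB hA

theorem collapsesTo_pOnePoly (hC : JoinClosed C) (hD : JoinClosed D) (hCD : PRel C ⊆ PRel D) :
    CollapsesTo (PRel C) (NPRel D) (POnePoly (NPRel D) C) := by
  rw [hC.pOnePoly_nPRel_eq_image2_symmDiff hD hCD]
  refine collapsesTo_of_subset (fun R hR => ⟨hC.pTwo_pRel_nPRel_subset hD hCD (hR 1),
    hC.pTwo_nPRel_pRel_subset hD hCD (hR 0)⟩) ?_ ?_ ?_ <;> rintro _ ⟨A, hA, B, hB, rfl⟩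
  · exact symmDiff_mem_pParallel hA hB
  · exact symmDiff_mem_pOrdered hA hB
  · rw [symmDiff_comm]
    exact symmDiff_mem_pOrdered hB hA

end JoinClosed

/-! ### The query order classes of the hierarchy -/

theorem language_mem_deltaP {ι : Type} [LinearOrder ι] [Finite ι] {M : DTM ι} (hM : M.PolyTime)
    {m : ℕ} {A : ι → Lang} (hA : ∀ i, A i ∈ DeltaP m) : M.language A ∈ DeltaP m := by
  cases m with
  | zero => exact language_mem_P hM hA
  | succ m => exact (joinClosed_sigmaP m).language_mem_pRel hM hA

theorem language_mem_sigmaP_inter_piP {ι : Type} [LinearOrder ι] [Finite ι] {M : DTM ι}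
    (hM : M.PolyTime) (hone : ∀ i, M.QueriesOnce i) {m : ℕ} {A : ι → Lang}
    (hA : ∀ i, A i ∈ SigmaP m ∩ PiP m) : M.language A ∈ SigmaP m ∩ PiP m := by
  cases m with
  | zero =>
    have h := language_mem_P hM fun i => (hA i).1
    exact ⟨h, h⟩
  | succ m => exact (joinClosed_sigmaP m).language_mem_nPRel_inter_co hM hone hA

section

variable {R : List (Finset (Fin 2)) → Prop} {C D : CClass} {m : ℕ}

theorem pTwo_subset_deltaP (hC : C ⊆ DeltaP m) (hD : D ⊆ DeltaP m) : PTwo R C D ⊆ DeltaP m := by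
  rintro _ ⟨A, hA, B, hB, M, hM, -, rfl⟩
  exact language_mem_deltaP hM (Fin.forall_fin_two.2 ⟨hC hA, hD hB⟩)

theorem pTwo_subset_sigmaP_inter_piP (hR : ∀ i, AllowsOnce R i) (hC : C ⊆ SigmaP m ∩ PiP m)
    (hD : D ⊆ SigmaP m ∩ PiP m) : PTwo R C D ⊆ SigmaP m ∩ PiP m := by
  rintro _ ⟨A, hA, B, hB, M, hM, hMR, rfl⟩
  exact language_mem_sigmaP_inter_piP hM (fun i => hMR.queriesOnce (hR i))
    (Fin.forall_fin_two.2 ⟨hC hA, hD hB⟩)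

end

theorem deltaP_nonempty (m : ℕ) : (DeltaP m).Nonempty :=
  joinClosed_P.1.mono (deltaP_mono m.zero_le)

theorem sigmaP_inter_piP_nonempty (m : ℕ) : (SigmaP m ∩ PiP m).Nonempty :=
  (deltaP_nonempty m).mono (deltaP_subset_sigmaP_inter_piP m)

theorem collapsesTo_deltaP {C : CClass} {m : ℕ} (hC : C ⊆ DeltaP m) (hne : C.Nonempty) :
    CollapsesTo (DeltaP m) C (DeltaP m) :=
  collapsesTo_left
    (fun _ _ => ⟨pTwo_subset_deltaP subset_rfl hC, pTwo_subset_deltaP hC subset_rfl⟩) hne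

theorem collapsesTo_sigmaP_inter_piP_right {C : CClass} {m : ℕ} (hC : C ⊆ SigmaP m ∩ PiP m)
    (hne : C.Nonempty) : CollapsesTo C (SigmaP m ∩ PiP m) (SigmaP m ∩ PiP m) :=
  collapsesTo_right (fun _ hR => ⟨pTwo_subset_sigmaP_inter_piP hR hC subset_rfl,
    pTwo_subset_sigmaP_inter_piP hR subset_rfl hC⟩) hne

theorem collapsesTo_sigmaP_inter_piP_left {C : CClass} {m : ℕ} (hC : C ⊆ SigmaP m ∩ PiP m)
    (hne : C.Nonempty) : CollapsesTo (SigmaP m ∩ PiP m) C (SigmaP m ∩ PiP m) :=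
  collapsesTo_left (fun _ hR => ⟨pTwo_subset_sigmaP_inter_piP hR subset_rfl hC,
    pTwo_subset_sigmaP_inter_piP hR hC subset_rfl⟩) hne

theorem collapsesTo_deltaP_sigmaP_of_lt {j k : ℕ} (hkj : k < j) :
    CollapsesTo (DeltaP j) (SigmaP k) (DeltaP j) :=
  collapsesTo_deltaP (sigmaP_subset_deltaP hkj) (joinClosed_sigmaP k).1

theorem collapsesTo_deltaP_sigmaP_of_le {j k : ℕ} (hj : 0 < j) (hjk : j ≤ k) :
    CollapsesTo (DeltaP j) (SigmaP k) (POnePoly (SigmaP k) (SigmaP (j - 1))) := by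
  obtain ⟨m, rfl⟩ := Nat.exists_eq_succ_of_ne_zero hj.ne'
  obtain ⟨n, rfl⟩ := Nat.exists_eq_succ_of_ne_zero (hj.trans_le hjk).ne'
  exact (joinClosed_sigmaP m).collapsesTo_pOnePoly (joinClosed_sigmaP n) (deltaP_mono hjk)

theorem collapsesTo_deltaP_sigmaP_inter_piP_of_lt {j k : ℕ} (hkj : k < j) :
    CollapsesTo (DeltaP j) (SigmaP k ∩ PiP k) (DeltaP j) :=
  collapsesTo_deltaP (Set.inter_subset_left.trans (sigmaP_subset_deltaP hkj))
    (sigmaP_inter_piP_nonempty k)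

theorem collapsesTo_deltaP_sigmaP_inter_piP_of_le {j k : ℕ} (hjk : j ≤ k) :
    CollapsesTo (DeltaP j) (SigmaP k ∩ PiP k) (SigmaP k ∩ PiP k) :=
  collapsesTo_sigmaP_inter_piP_right
    ((deltaP_subset_sigmaP_inter_piP j).trans (sigmaP_inter_piP_mono hjk)) (deltaP_nonempty j)

theorem collapsesTo_sigmaP_inter_piP_max (j k : ℕ) :
    CollapsesTo (SigmaP j ∩ PiP j) (SigmaP k ∩ PiP k) (SigmaP (max j k) ∩ PiP (max j k)) := by
  rcases le_total j k with h | h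
  · rw [max_eq_right h]
    exact collapsesTo_sigmaP_inter_piP_right (sigmaP_inter_piP_mono h) (sigmaP_inter_piP_nonempty j)
  · rw [max_eq_left h]
    exact collapsesTo_sigmaP_inter_piP_left (sigmaP_inter_piP_mono h) (sigmaP_inter_piP_nonempty k)

end QueryOrder

open QueryOrder in
theorem corollaryc :
    (∀ j k : ℕ, 0 < j →
      PParallel (DeltaP j) (SigmaP k) = POrdered (DeltaP j) (SigmaP k) ∧
      POrdered (DeltaP j) (SigmaP k) = POrdered (SigmaP k) (DeltaP j) ∧
      POrdered (SigmaP k) (DeltaP j) = PAnyOrder (SigmaP k) (DeltaP j) ∧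
      PAnyOrder (SigmaP k) (DeltaP j) =
        if k < j then DeltaP j else POnePoly (SigmaP k) (SigmaP (j - 1))) ∧
    (∀ j k : ℕ,
      PParallel (DeltaP j) (SigmaP k ∩ PiP k) = POrdered (DeltaP j) (SigmaP k ∩ PiP k) ∧
      POrdered (DeltaP j) (SigmaP k ∩ PiP k) = POrdered (SigmaP k ∩ PiP k) (DeltaP j) ∧
      POrdered (SigmaP k ∩ PiP k) (DeltaP j) = PAnyOrder (SigmaP k ∩ PiP k) (DeltaP j) ∧
      PAnyOrder (SigmaP k ∩ PiP k) (DeltaP j) =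
        if k < j then DeltaP j else SigmaP k ∩ PiP k) ∧
    (∀ j k : ℕ,
      PParallel (SigmaP j ∩ PiP j) (SigmaP k ∩ PiP k) =
        POrdered (SigmaP j ∩ PiP j) (SigmaP k ∩ PiP k) ∧
      POrdered (SigmaP j ∩ PiP j) (SigmaP k ∩ PiP k) =
        POrdered (SigmaP k ∩ PiP k) (SigmaP j ∩ PiP j) ∧
      POrdered (SigmaP k ∩ PiP k) (SigmaP j ∩ PiP j) =
        PAnyOrder (SigmaP k ∩ PiP k) (SigmaP j ∩ PiP j) ∧
      PAnyOrder (SigmaP k ∩ PiP k) (SigmaP j ∩ PiP j) =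
        SigmaP (max j k) ∩ PiP (max j k)) := by
  refine ⟨fun j k hj => ?_, fun j k => ?_, collapsesTo_sigmaP_inter_piP_max⟩
  · split_ifs with hkj
    · exact collapsesTo_deltaP_sigmaP_of_lt hkj
    · exact collapsesTo_deltaP_sigmaP_of_le hj (not_lt.1 hkj)
  · split_ifs with hkj
    · exact collapsesTo_deltaP_sigmaP_inter_piP_of_lt hkj
    · exact collapsesTo_deltaP_sigmaP_inter_piP_of_le (not_lt.1 hkj)
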